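/- Let $D=2n$, let $\theta$ be a nonzero real number and let $\Theta=\theta\,\mathrm{diag}(J,\dots,J)$ with $n$ blocks $J=\begin{pmatrix}0&-1\\1&0\end{pmatrix}$. For Schwartz functions $a,b\in\mathcal S=\mathcal S(\mathbb R^D)$ (complex valued) let $$(a\star b)(x)=\frac1{(\pi\theta)^D}\int d^Dy\,d^Dz\;a(x+y)\,b(x+z)\,e^{-2i\,y\Theta^{-1}z}\in\mathcal S .$$ For a tempered distribution $T\in\mathcal S'$ and $a\in\mathcal S$ define $T\star a,\ a\star T\in\mathcal S'$ by $\langle T\star a,b\rangle=\langle T,a\star b\rangle$ and $\langle a\star T,b\rangle=\langle T,b\star a\rangle$. The Moyal algebra $\mathcal M$ is the set of $T\in\mathcal S'$ such that $T\star a\in\mathcal S$ and $a\star T\in\mathcal S$ for all $a\in\mathcal S$. For $R,T\in\mathcal M$ the product $R\star T$ is given by $\langle R\star T,a\rangle=\langle R,T\star a\rangle$ for $a\in\mathcal S$, and the Moyal bracket is $[R,T]_\star=R\star T-T\star R$. Let $\mathcal P_2$ be the set of polynomial functions on $\mathbb R^D$ with complex coefficients and degree $\le 2$, regarded as tempered distributions,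 and for polynomial functions let $\{a,b\}_{PB}=\sum_{\mu,\nu}\Theta_{\mu\nu}\,\frac{\partial a}{\partial x_\mu}\frac{\partial b}{\partial x_\nu}$. Then $\mathcal P_2\subset\mathcal M$; the set $\mathcal P_2$ is closed under the Moyal bracket and is a complex Lie algebra for it; and $$[P_1,P_2]_\star=i\,\{P_1,P_2\}_{PB}\qquad\text{for all }P_1,P_2\in\mathcal P_2 .$$ -/

import Mathlib

namespace Moyal

open MeasureTheory FourierTransform SchwartzMap
open scoped ContDiff Matrix

section Aux

variable {E : Type} [NormedAddCommGroup E] [InnerProductSpace ℝ E]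

lemma norm_iteratedFDeriv_comp_le_of_contraction {V : Type} [NormedAddCommGroup V] [NormedSpace ℝ V]
    (f : 𝓢(E, ℂ)) (L : V →L[ℝ] E) (hL : ‖L‖ ≤ 1) (n : ℕ) (w : V) :
    ‖iteratedFDeriv ℝ n (fun w => f (L w)) w‖ ≤ ‖iteratedFDeriv ℝ n f (L w)‖ := by
  have h := L.iteratedFDeriv_comp_right (f.smooth ⊤) w (i := n) (mod_cast le_top)
  change ‖iteratedFDeriv ℝ n (f ∘ L) w‖ ≤ _
  rw [h]
  refine (ContinuousMultilinearMap.norm_compContinuousLinearMap_le _ _).trans ?_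
  refine mul_le_of_le_one_right (norm_nonneg _) ?_
  exact Finset.prod_le_one (fun _ _ => norm_nonneg _) (fun _ _ => hL)

/-- For a fixed Schwartz function `a`, the map sending `b` to `(y, x) ↦ a y * b x`. -/
noncomputable def tensorCLM (a : 𝓢(E, ℂ)) : 𝓢(E, ℂ) →L[ℂ] 𝓢(WithLp 2 (E × E), ℂ) :=
  mkCLM (fun b w => a w.fst * b w.snd) (fun _ _ _ => by simp [mul_add])
    (fun _ _ _ => by simp [mul_left_comm])
    (fun b => ((a.smooth ⊤).comp (WithLp.fstL 2 ℝ E E).contDiff).mul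
      ((b.smooth ⊤).comp (WithLp.sndL 2 ℝ E E).contDiff)) <| by
  rintro ⟨k, n⟩
  have hn1 : ‖WithLp.fstL 2 ℝ E E‖ ≤ 1 :=
    ContinuousLinearMap.opNorm_le_bound _ zero_le_one fun w => by
      simpa using WithLp.norm_fst_le (p := 2) (x := w)
  have hn2 : ‖WithLp.sndL 2 ℝ E E‖ ≤ 1 :=
    ContinuousLinearMap.opNorm_le_bound _ zero_le_one fun w => by
      simpa using WithLp.norm_snd_le (p := 2) (x := w)
  set A : ℝ := 2 ^ k * (Finset.Iic (k, n)).sup (schwartzSeminormFamily ℂ E ℂ) a with hA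
  refine ⟨Finset.Iic (k, n), ∑ i ∈ Finset.range (n + 1), n.choose i * A * 2 ^ k,
    by positivity, fun b w => ?_⟩
  set B : ℝ := (Finset.Iic (k, n)).sup (schwartzSeminormFamily ℂ E ℂ) b with hB
  have hmul := norm_iteratedFDeriv_mul_le (𝕜 := ℝ) (N := ∞) (n := n)
    ((a.smooth ⊤).comp (WithLp.fstL 2 ℝ E E).contDiff)
    ((b.smooth ⊤).comp (WithLp.sndL 2 ℝ E E).contDiff) w (mod_cast le_top)
  have hw : ‖w‖ ≤ ‖w.fst‖ + ‖w.snd‖ := by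
    rw [WithLp.prod_norm_eq_of_L2]
    refine Real.sqrt_le_iff.2 ⟨by positivity, ?_⟩
    nlinarith [norm_nonneg w.fst, norm_nonneg w.snd]
  have hw' : ‖w‖ ^ k ≤ (1 + ‖w.fst‖) ^ k * (1 + ‖w.snd‖) ^ k := by
    rw [← mul_pow]
    gcongr
    nlinarith [norm_nonneg w.fst, norm_nonneg w.snd]
  calc ‖w‖ ^ k * ‖iteratedFDeriv ℝ n (fun w : WithLp 2 (E × E) => a w.fst * b w.snd) w‖
      ≤ ((1 + ‖w.fst‖) ^ k * (1 + ‖w.snd‖) ^ k) *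
        ∑ i ∈ Finset.range (n + 1), (n.choose i : ℝ) *
          ‖iteratedFDeriv ℝ i a w.fst‖ * ‖iteratedFDeriv ℝ (n - i) b w.snd‖ := by
        refine mul_le_mul hw' (hmul.trans ?_) (norm_nonneg _) (by positivity)
        refine Finset.sum_le_sum fun i _ => ?_
        gcongr
        · exact norm_iteratedFDeriv_comp_le_of_contraction a (WithLp.fstL 2 ℝ E E) hn1 i w
        · exact norm_iteratedFDeriv_comp_le_of_contraction b (WithLp.sndL 2 ℝ E E) hn2 (n - i) w
    _ ≤ (∑ i ∈ Finset.range (n + 1), n.choose i * A * 2 ^ k) * B := by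
        rw [Finset.mul_sum, Finset.sum_mul]
        refine Finset.sum_le_sum fun i hi => ?_
        have hi' : i ≤ n := Nat.lt_succ_iff.1 (Finset.mem_range.1 hi)
        have h1 := one_add_le_sup_seminorm_apply (𝕜 := ℂ) (m := (k, n)) le_rfl hi' a w.fst
        have h2 := one_add_le_sup_seminorm_apply (𝕜 := ℂ) (m := (k, n)) le_rfl
          (Nat.sub_le n i) b w.snd
        calc _ = (n.choose i : ℝ) * ((1 + ‖w.fst‖) ^ k * ‖iteratedFDeriv ℝ i a w.fst‖) *
              ((1 + ‖w.snd‖) ^ k * ‖iteratedFDeriv ℝ (n - i) b w.snd‖) := by ring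
          _ ≤ (n.choose i : ℝ) * A * (2 ^ k * B) :=
              mul_le_mul (mul_le_mul_of_nonneg_left h1 (by positivity)) h2 (by positivity)
                (by positivity)
          _ = _ := by ring

lemma tensorCLM_apply (a b : 𝓢(E, ℂ)) (w : WithLp 2 (E × E)) :
    tensorCLM a b w = a w.fst * b w.snd := rfl


/-- The embedding `x ↦ (0, x)`. -/
noncomputable def sndEmb (E : Type) [NormedAddCommGroup E] [InnerProductSpace ℝ E] :
    E →L[ℝ] WithLp 2 (E × E) :=
  (WithLp.prodContinuousLinearEquiv 2 ℝ E E).symm.toContinuousLinearMap ∘L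
    ContinuousLinearMap.inr ℝ E E

lemma sndEmb_apply (x : E) : sndEmb E x = WithLp.toLp 2 (0, x) := rfl

lemma antilipschitz_sndEmb : AntilipschitzWith 1 (sndEmb E) :=
  (AddMonoidHomClass.isometry_of_norm (sndEmb E) fun x => by
    simp [sndEmb_apply]).antilipschitz

section Marginal

variable [FiniteDimensional ℝ E] [MeasurableSpace E] [BorelSpace E]

/-- The continuous linear map `G ↦ (x ↦ ∫ y, G (y, x))` on Schwartz functions. -/
noncomputable def marginalCLM : 𝓢(WithLp 2 (E × E), ℂ) →L[ℂ] 𝓢(E, ℂ) :=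
  (fourierInvCLM ℂ 𝓢(E, ℂ)) ∘L
    (compCLMOfAntilipschitz ℂ (sndEmb E).hasTemperateGrowth antilipschitz_sndEmb) ∘L
    (fourierCLM ℂ 𝓢(WithLp 2 (E × E), ℂ))

lemma integrable_prod (G : 𝓢(WithLp 2 (E × E), ℂ)) :
    Integrable (fun p : E × E => G (WithLp.toLp 2 p)) (volume.prod volume) :=
  ((WithLp.volume_preserving_toLp E E).integrable_comp_emb
    (MeasurableEquiv.toLp 2 (E × E)).measurableEmbedding).2 G.integrable

lemma continuous_marginal (G : 𝓢(WithLp 2 (E × E), ℂ)) :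
    Continuous fun x : E => ∫ y : E, G (WithLp.toLp 2 (y, x)) := by
  set r := (volume : Measure E).integrablePower
  set C := 2 ^ r * ((Finset.Iic (r, 0)).sup fun m => SchwartzMap.seminorm ℂ m.1 m.2) G
  refine continuous_of_dominated (bound := fun y => C * (1 + ‖y‖) ^ (-(r : ℝ))) ?_ ?_ ?_ ?_
  · intro x
    exact (G.continuous.comp (by fun_prop)).aestronglyMeasurable
  · intro x
    refine Filter.Eventually.of_forall fun y => ?_
    have h := one_add_le_sup_seminorm_apply (𝕜 := ℂ) (m := (r, 0)) le_rfl le_rfl G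
      (WithLp.toLp 2 (y, x))
    rw [norm_iteratedFDeriv_zero] at h
    have h2 : ‖y‖ ≤ ‖WithLp.toLp 2 (y, x)‖ := by
      simpa using WithLp.norm_fst_le (p := 2) (x := WithLp.toLp 2 (y, x))
    rw [Real.rpow_neg (by positivity), Real.rpow_natCast, ← div_eq_mul_inv,
      le_div_iff₀ (by positivity), mul_comm]
    refine le_trans ?_ h
    gcongr
  · exact (Measure.integrable_pow_neg_integrablePower volume).const_mul C
  · exact Filter.Eventually.of_forall fun y => G.continuous.comp (by fun_prop)

lemma marginalCLM_apply (G : 𝓢(WithLp 2 (E × E), ℂ)) (x : E) :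
    marginalCLM G x = ∫ y : E, G (WithLp.toLp 2 (y, x)) := by
  set h : E → ℂ := fun x => ∫ y : E, G (WithLp.toLp 2 (y, x)) with hh
  set R : 𝓢(E, ℂ) :=
    compCLMOfAntilipschitz ℂ (sndEmb E).hasTemperateGrowth antilipschitz_sndEmb (𝓕 G) with hR
  have hint : Integrable h := (integrable_prod G).integral_prod_right
  have hF : 𝓕 h = R := by
    funext w
    have hRw : R w = 𝓕 (G : WithLp 2 (E × E) → ℂ) (WithLp.toLp 2 (0, w)) := rfl
    rw [hRw, Real.fourier_eq, Real.fourier_eq,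
      ← (WithLp.volume_preserving_toLp E E).integral_comp
        (MeasurableEquiv.toLp 2 (E × E)).measurableEmbedding]
    change _ = ∫ p : E × E, _ ∂(volume.prod volume)
    rw [integral_prod_symm]
    · refine integral_congr_ae (Filter.Eventually.of_forall fun x => ?_)
      change 𝐞 (-inner ℝ x w) • (∫ y : E, G (WithLp.toLp 2 (y, x))) = ∫ y : E,
        𝐞 (-inner ℝ (WithLp.toLp 2 (y, x)) (WithLp.toLp 2 ((0 : E), w))) • G (WithLp.toLp 2 (y, x))
      simp only [Circle.smul_def, smul_eq_mul, WithLp.prod_inner_apply, inner_zero_right, zero_add]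
      rw [integral_const_mul]
    · refine (integrable_prod G).mono ?_ (Filter.Eventually.of_forall fun p => by
        simp [Circle.smul_def, Circle.norm_coe])
      refine Continuous.aestronglyMeasurable ?_
      have := G.continuous
      fun_prop
  have : (marginalCLM G : E → ℂ) = 𝓕⁻ (R : E → ℂ) := SchwartzMap.fourierInv_coe R
  rw [this, ← hF, (continuous_marginal G).fourierInv_fourier_eq hint (by rw [hF]; exact R.integrable)]

end Marginal

lemma hasTemperateGrowth_exp_I : (fun t : ℝ => Complex.exp (Complex.I * t)).HasTemperateGrowth := by
  have h0 : ContDiff ℝ ∞ (fun t : ℝ => Complex.exp (Complex.I * t)) :=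
    (contDiff_const.mul Complex.ofRealCLM.contDiff).cexp
  refine ⟨h0, fun n => ⟨0, 1, fun t => ?_⟩⟩
  rw [norm_iteratedFDeriv_eq_norm_iteratedDeriv]
  have h : ∀ n : ℕ, iteratedDeriv n (fun t : ℝ => Complex.exp (Complex.I * t)) =
      fun t : ℝ => Complex.I ^ n * Complex.exp (Complex.I * t) := by
    intro n
    induction n with
    | zero => simp
    | succ n ih =>
      rw [iteratedDeriv_succ, ih]
      funext t
      have h1 : HasDerivAt (fun t : ℝ => Complex.I * (t : ℂ)) Complex.I t := by
        simpa using (Complex.ofRealCLM.hasDerivAt (x := t)).const_mul Complex.I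
      rw [(h1.cexp.const_mul _).deriv]
      ring
  rw [h]
  simp [mul_comm Complex.I, Complex.norm_exp_ofReal_mul_I]

/-- The linear automorphism `(y, x) ↦ (x + y, y)`. -/
noncomputable def shear (E : Type) [NormedAddCommGroup E] [InnerProductSpace ℝ E]
    [FiniteDimensional ℝ E] : WithLp 2 (E × E) ≃L[ℝ] WithLp 2 (E × E) :=
  LinearEquiv.toContinuousLinearEquiv
    { toFun := fun w => WithLp.toLp 2 (w.snd + w.fst, w.fst)
      invFun := fun w => WithLp.toLp 2 (w.snd, w.fst - w.snd)
      map_add' := fun v w => by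
        refine WithLp.ofLp_injective 2 (Prod.ext ?_ ?_) <;> simp [add_add_add_comm]
      map_smul' := fun c w => by
        refine WithLp.ofLp_injective 2 (Prod.ext ?_ ?_) <;> simp [smul_add]
      left_inv := fun w => by
        refine WithLp.ofLp_injective 2 (Prod.ext ?_ ?_) <;> simp
      right_inv := fun w => by
        refine WithLp.ofLp_injective 2 (Prod.ext ?_ ?_) <;> simp }

/-- The linear automorphism `(y, x) ↦ (x, y)`. -/
noncomputable def swap (E : Type) [NormedAddCommGroup E] [InnerProductSpace ℝ E]
    [FiniteDimensional ℝ E] : WithLp 2 (E × E) ≃L[ℝ] WithLp 2 (E × E) :=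
  LinearEquiv.toContinuousLinearEquiv
    { toFun := fun w => WithLp.toLp 2 (w.snd, w.fst)
      invFun := fun w => WithLp.toLp 2 (w.snd, w.fst)
      map_add' := fun v w => by
        refine WithLp.ofLp_injective 2 (Prod.ext ?_ ?_) <;> simp
      map_smul' := fun c w => by
        refine WithLp.ofLp_injective 2 (Prod.ext ?_ ?_) <;> simp
      left_inv := fun w => by
        refine WithLp.ofLp_injective 2 (Prod.ext ?_ ?_) <;> simp
      right_inv := fun w => by
        refine WithLp.ofLp_injective 2 (Prod.ext ?_ ?_) <;> simp }

/-- The oscillating factor `(y, x) ↦ exp (2 i ⟪x, A y⟫)`. -/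
noncomputable def phase (A : E ≃L[ℝ] E) (w : WithLp 2 (E × E)) : ℂ :=
  Complex.exp (Complex.I * ((2 * inner ℝ w.snd (A w.fst) : ℝ) : ℂ))

lemma phase_apply (A : E ≃L[ℝ] E) (x y : E) : phase A (WithLp.toLp 2 (y, x)) =
    Complex.exp (Complex.I * ((2 * inner ℝ x (A y) : ℝ) : ℂ)) := rfl

lemma hasTemperateGrowth_phase (A : E ≃L[ℝ] E) : (phase A).HasTemperateGrowth := by
  have h1 : (fun w : WithLp 2 (E × E) => w.snd).HasTemperateGrowth :=
    (WithLp.sndL 2 ℝ E E).hasTemperateGrowth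
  have h2 : (fun w : WithLp 2 (E × E) => A w.fst).HasTemperateGrowth :=
    (A.toContinuousLinearMap ∘L WithLp.fstL 2 ℝ E E).hasTemperateGrowth
  have h3 : (fun w : WithLp 2 (E × E) => inner ℝ w.snd (A w.fst)).HasTemperateGrowth :=
    (innerSL ℝ).bilinear_hasTemperateGrowth h1 h2
  exact hasTemperateGrowth_exp_I.comp ((Function.HasTemperateGrowth.const (2 : ℝ)).mul h3)

variable [FiniteDimensional ℝ E] [MeasurableSpace E] [BorelSpace E]

/-- The function `y ↦ 𝓕 b (A y / π)`. -/
noncomputable def scaledFourierCLM (A : E ≃L[ℝ] E) : 𝓢(E, ℂ) →L[ℂ] 𝓢(E, ℂ) :=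
  compCLMOfContinuousLinearEquiv ℂ
    (A.trans (ContinuousLinearEquiv.smulLeft (Units.mk0 (Real.pi⁻¹) (by positivity)))) ∘L
    fourierCLM ℂ 𝓢(E, ℂ)

/-- Integration over `y` of `(y, x) ↦ exp (2 i ⟪x, A y⟫) G (x + y, y)`. -/
noncomputable def twistCLM (A : E ≃L[ℝ] E) : 𝓢(WithLp 2 (E × E), ℂ) →L[ℂ] 𝓢(E, ℂ) :=
  marginalCLM ∘L smulLeftCLM ℂ (phase A) ∘L compCLMOfContinuousLinearEquiv ℂ (shear E)

lemma twistCLM_apply (A : E ≃L[ℝ] E) (a b : 𝓢(E, ℂ)) (x : E) :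
    twistCLM A (tensorCLM a (scaledFourierCLM A b)) x =
      ∫ y : E, ∫ z : E, a (x + y) * b (x + z) *
        Complex.exp (-(2 * Complex.I * (inner ℝ z (A y) : ℝ))) := by
  change marginalCLM _ x = _
  rw [marginalCLM_apply]
  refine integral_congr_ae (Filter.Eventually.of_forall fun y => ?_)
  change smulLeftCLM ℂ (phase A) (compCLMOfContinuousLinearEquiv ℂ (shear E)
    (tensorCLM a (scaledFourierCLM A b))) (WithLp.toLp 2 (y, x)) = _
  rw [smulLeftCLM_apply_apply (hasTemperateGrowth_phase A)]
  change phase A (WithLp.toLp 2 (y, x)) • (a (x + y) * 𝓕 (b : E → ℂ) (Real.pi⁻¹ • A y)) =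
    ∫ z : E, a (x + y) * b (x + z) * Complex.exp (-(2 * Complex.I * (inner ℝ z (A y) : ℝ)))
  rw [← integral_add_left_eq_self (μ := (volume : Measure E)) _ (-x), Real.fourier_eq,
    smul_eq_mul, ← mul_assoc, ← integral_const_mul]
  refine integral_congr_ae (Filter.Eventually.of_forall fun z => ?_)
  simp only [phase_apply, Circle.smul_def, smul_eq_mul, Real.fourierChar_apply, add_neg_cancel_left,
    inner_add_left, inner_neg_left, inner_smul_right]
  have hpi : (Real.pi : ℂ) ≠ 0 := by exact_mod_cast Real.pi_ne_zero
  have : Complex.exp (-(2 * Complex.I * ((-inner ℝ x (A y) + inner ℝ z (A y) : ℝ) : ℂ))) =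
      Complex.exp (Complex.I * ((2 * inner ℝ x (A y) : ℝ) : ℂ)) *
      Complex.exp (((2 * Real.pi * -(Real.pi⁻¹ * inner ℝ z (A y)) : ℝ) : ℂ) * Complex.I) := by
    rw [← Complex.exp_add]
    congr 1
    push_cast
    field_simp
    ring
  rw [this]
  ring

end Aux

noncomputable section Algebra

/-- The space `ℝ ^ D`, `D = 2 n`: the pair `(i, k)` stands for the `i`-th coordinate of the `k`-th
plane. -/
abbrev Space (n : ℕ) : Type := EuclideanSpace ℝ (Fin 2 × Fin n)

/-- The block-diagonal matrix `diag (J, …, J)` with `n` blocks `J`. -/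
def sigma (n : ℕ) : Matrix (Fin 2 × Fin n) (Fin 2 × Fin n) ℝ :=
  Matrix.blockDiagonal fun _ => !![0, -1; 1, 0]

/-- `Θ = θ Σ`. -/
def theta (n : ℕ) (θ : ℝ) : Matrix (Fin 2 × Fin n) (Fin 2 × Fin n) ℝ := θ • sigma n

variable {n : ℕ} {θ : ℝ}

lemma sigma_mul_sigma (n : ℕ) : sigma n * sigma n = -1 := by
  have h : (!![0, -1; 1, 0] : Matrix (Fin 2) (Fin 2) ℝ) * !![0, -1; 1, 0] = -1 := by
    ext i j; fin_cases i <;> fin_cases j <;> simp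
  rw [sigma, ← Matrix.blockDiagonal_mul, h, ← Matrix.blockDiagonal_one, ← Matrix.blockDiagonal_neg]
  rfl

lemma theta_mul_inv (hθ : θ ≠ 0) : theta n θ * (theta n θ)⁻¹ = 1 := by
  refine Matrix.mul_nonsing_inv _ ?_
  refine (Matrix.isUnit_iff_isUnit_det _).1 ?_
  have h : theta n θ * ((-θ⁻¹) • sigma n) = 1 := by
    simp [theta, sigma_mul_sigma, smul_smul, hθ]
  exact IsUnit.of_mul_eq_one _ h

/-- The linear automorphism `A` of `ℝ ^ D` with `⟪z, A y⟫ = y Θ⁻¹ z`. -/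
def invEquiv (n : ℕ) (hθ : θ ≠ 0) : Space n ≃L[ℝ] Space n :=
  LinearEquiv.toContinuousLinearEquiv
    (LinearEquiv.ofLinearMap (Matrix.toLpLin 2 2 ((theta n θ)⁻¹)ᵀ) (Matrix.toLpLin 2 2 (theta n θ)ᵀ)
      (by rw [← Matrix.toLpLin_mul_same, ← Matrix.transpose_mul, theta_mul_inv hθ]; simp)
      (by rw [← Matrix.toLpLin_mul_same, ← Matrix.transpose_mul,
            mul_eq_one_comm.1 (theta_mul_inv hθ)]; simp))

lemma inner_invEquiv (hθ : θ ≠ 0) (y z : Space n) :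
    inner ℝ z (invEquiv n hθ y) = y.ofLp ⬝ᵥ (theta n θ)⁻¹ *ᵥ z.ofLp := by
  change inner ℝ z (Matrix.toLpLin 2 2 ((theta n θ)⁻¹)ᵀ y) = _
  rw [EuclideanSpace.inner_eq_star_dotProduct, Matrix.ofLp_toLpLin, star_trivial,
    Matrix.toLin'_apply, Matrix.mulVec_transpose, Matrix.dotProduct_mulVec]

/-- The integral formula
`(a ⋆ b)(x) = (π θ)^(-D) ∫ dy dz a(x + y) b(x + z) exp (- 2 i y Θ⁻¹ z)`. -/
def starFun (θ : ℝ) (a b : 𝓢(Space n, ℂ)) (x : Space n) : ℂ :=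
  (((Real.pi * θ) ^ (2 * n) : ℝ) : ℂ)⁻¹ * ∫ y : Space n, ∫ z : Space n, a (x + y) * b (x + z) *
    Complex.exp (-(2 * Complex.I * ((y.ofLp ⬝ᵥ (theta n θ)⁻¹ *ᵥ z.ofLp : ℝ) : ℂ)))

/-- Auxiliary form of `b ↦ a ⋆ b`. -/
def starAuxLeft (hθ : θ ≠ 0) (a : 𝓢(Space n, ℂ)) : 𝓢(Space n, ℂ) →L[ℂ] 𝓢(Space n, ℂ) :=
  (((Real.pi * θ) ^ (2 * n) : ℝ) : ℂ)⁻¹ •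
    (twistCLM (invEquiv n hθ) ∘L tensorCLM a ∘L scaledFourierCLM (invEquiv n hθ))

/-- Auxiliary form of `a ↦ a ⋆ b`. -/
def starAuxRight (hθ : θ ≠ 0) (b : 𝓢(Space n, ℂ)) : 𝓢(Space n, ℂ) →L[ℂ] 𝓢(Space n, ℂ) :=
  (((Real.pi * θ) ^ (2 * n) : ℝ) : ℂ)⁻¹ •
    (twistCLM (invEquiv n hθ) ∘L compCLMOfContinuousLinearEquiv ℂ (swap (Space n)) ∘L
      tensorCLM (scaledFourierCLM (invEquiv n hθ) b))

lemma starAuxLeft_apply (hθ : θ ≠ 0) (a b : 𝓢(Space n, ℂ)) (x : Space n) :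
    starAuxLeft hθ a b x = starFun θ a b x := by
  change _ * twistCLM (invEquiv n hθ) (tensorCLM a (scaledFourierCLM (invEquiv n hθ) b)) x = _
  simp only [twistCLM_apply, starFun, inner_invEquiv]

lemma starAuxRight_eq (hθ : θ ≠ 0) (a b : 𝓢(Space n, ℂ)) :
    starAuxRight hθ b a = starAuxLeft hθ a b := by
  have h : compCLMOfContinuousLinearEquiv ℂ (swap (Space n))
      (tensorCLM (scaledFourierCLM (invEquiv n hθ) b) a) =
      tensorCLM a (scaledFourierCLM (invEquiv n hθ) b) := by
    ext w
    exact mul_comm _ _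
  exact congrArg (fun G => (((Real.pi * θ) ^ (2 * n) : ℝ) : ℂ)⁻¹ • twistCLM (invEquiv n hθ) G) h

variable [NeZero θ]

variable (θ) in
/-- The Moyal product `⋆ : 𝓢 × 𝓢 → 𝓢`. -/
def star (a b : 𝓢(Space n, ℂ)) : 𝓢(Space n, ℂ) where
  toFun := starFun θ a b
  smooth' := by
    rw [← funext (starAuxLeft_apply (NeZero.ne θ) a b)]
    exact (starAuxLeft (NeZero.ne θ) a b).smooth'
  decay' := by
    rw [← funext (starAuxLeft_apply (NeZero.ne θ) a b)]
    exact (starAuxLeft (NeZero.ne θ) a b).decay'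

lemma star_eq_left (a b : 𝓢(Space n, ℂ)) : star θ a b = starAuxLeft (NeZero.ne θ) a b :=
  SchwartzMap.ext fun x => (starAuxLeft_apply (NeZero.ne θ) a b x).symm

lemma star_eq_right (a b : 𝓢(Space n, ℂ)) : star θ a b = starAuxRight (NeZero.ne θ) b a := by
  rw [star_eq_left, starAuxRight_eq]

variable (θ) in
/-- The continuous linear map `b ↦ a ⋆ b` on `𝓢`. -/
def starLeftCLM (a : 𝓢(Space n, ℂ)) : 𝓢(Space n, ℂ) →L[ℂ] 𝓢(Space n, ℂ) where
  toFun b := star θ a b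
  map_add' b c := by simp only [star_eq_left, map_add]
  map_smul' r b := by simp only [star_eq_left, map_smul, RingHom.id_apply]
  cont := by simpa only [star_eq_left] using (starAuxLeft (NeZero.ne θ) a).continuous

variable (θ) in
/-- The continuous linear map `a ↦ a ⋆ b` on `𝓢`. -/
def starRightCLM (b : 𝓢(Space n, ℂ)) : 𝓢(Space n, ℂ) →L[ℂ] 𝓢(Space n, ℂ) where
  toFun a := star θ a b
  map_add' a c := by simp only [star_eq_right, map_add]
  map_smul' r a := by simp only [star_eq_right, map_smul, RingHom.id_apply]
  cont := by simpa only [star_eq_right] using (starAuxRight (NeZero.ne θ) b).continuous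

variable (θ) in
/-- `T ⋆ a` for a tempered distribution `T`: `⟨T ⋆ a, b⟩ = ⟨T, a ⋆ b⟩`. -/
def distStar (T : 𝓢'(Space n, ℂ)) (a : 𝓢(Space n, ℂ)) : 𝓢'(Space n, ℂ) :=
  PointwiseConvergenceCLM.precomp ℂ (starLeftCLM θ a) T

variable (θ) in
/-- `a ⋆ T` for a tempered distribution `T`: `⟨a ⋆ T, b⟩ = ⟨T, b ⋆ a⟩`. -/
def starDist (a : 𝓢(Space n, ℂ)) (T : 𝓢'(Space n, ℂ)) : 𝓢'(Space n, ℂ) :=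
  PointwiseConvergenceCLM.precomp ℂ (starRightCLM θ a) T

lemma distStar_apply (T : 𝓢'(Space n, ℂ)) (a b : 𝓢(Space n, ℂ)) :
    distStar θ T a b = T (star θ a b) := rfl

lemma starDist_apply (T : 𝓢'(Space n, ℂ)) (a b : 𝓢(Space n, ℂ)) :
    starDist θ a T b = T (star θ b a) := rfl

/-- The embedding of `𝓢` into `𝓢'`, `⟨f, g⟩ = ∫ f g`. -/
abbrev emb : 𝓢(Space n, ℂ) →L[ℂ] 𝓢'(Space n, ℂ) :=
  toTemperedDistributionCLM (Space n) ℂ volume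

lemma emb_injective : Function.Injective (emb (n := n)) := by
  intro f g h
  rw [emb, ← Lp.toTemperedDistribution_toLp_eq (p := 2), ← Lp.toTemperedDistribution_toLp_eq (p := 2)] at h
  have hk := LinearMap.ker_eq_bot.1
    (Lp.ker_toTemperedDistributionCLM_eq_bot (E := Space n) (F := ℂ) (μ := volume) (p := 2))
  exact injective_toLp 2 volume (hk h)

variable (n θ) in
/-- `𝓜_L = {T ∈ 𝓢' | a ⋆ T ∈ 𝓢 for all a ∈ 𝓢}`. -/
def multL : Submodule ℂ 𝓢'(Space n, ℂ) where
  carrier := {T | ∀ a : 𝓢(Space n, ℂ), ∃ f : 𝓢(Space n, ℂ), emb f = starDist θ a T}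
  zero_mem' a := ⟨0, by rw [map_zero, starDist, map_zero]⟩
  add_mem' {S T} hS hT a := by
    obtain ⟨f, hf⟩ := hS a
    obtain ⟨g, hg⟩ := hT a
    exact ⟨f + g, by rw [map_add, hf, hg, starDist, starDist, starDist, map_add]⟩
  smul_mem' c T hT a := by
    obtain ⟨f, hf⟩ := hT a
    exact ⟨c • f, by rw [map_smul, hf, starDist, starDist, map_smul]⟩

variable (n θ) in
/-- `𝓜_R = {T ∈ 𝓢' | T ⋆ a ∈ 𝓢 for all a ∈ 𝓢}`. -/
def multR : Submodule ℂ 𝓢'(Space n, ℂ) where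
  carrier := {T | ∀ a : 𝓢(Space n, ℂ), ∃ f : 𝓢(Space n, ℂ), emb f = distStar θ T a}
  zero_mem' a := ⟨0, by rw [map_zero, distStar, map_zero]⟩
  add_mem' {S T} hS hT a := by
    obtain ⟨f, hf⟩ := hS a
    obtain ⟨g, hg⟩ := hT a
    exact ⟨f + g, by rw [map_add, hf, hg, distStar, distStar, distStar, map_add]⟩
  smul_mem' c T hT a := by
    obtain ⟨f, hf⟩ := hT a
    exact ⟨c • f, by rw [map_smul, hf, distStar, distStar, map_smul]⟩

variable (n θ) in
/-- The Moyal algebra `𝓜 = 𝓜_L ∩ 𝓜_R`. -/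
def moyalAlgebra : Submodule ℂ 𝓢'(Space n, ℂ) := multL n θ ⊓ multR n θ

/-- For `T ∈ 𝓜`, the linear map `a ↦ T ⋆ a` from `𝓢` to `𝓢`. -/
def act (T : moyalAlgebra n θ) : 𝓢(Space n, ℂ) →ₗ[ℂ] 𝓢(Space n, ℂ) where
  toFun a := (T.2.2 a).choose
  map_add' a b := by
    apply emb_injective
    rw [map_add, (T.2.2 (a + b)).choose_spec, (T.2.2 a).choose_spec, (T.2.2 b).choose_spec]
    ext c
    change T.1 (star θ (a + b) c) = T.1 (star θ a c) + T.1 (star θ b c)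
    rw [← map_add]
    exact congrArg T.1 ((starRightCLM θ c).map_add a b)
  map_smul' r a := by
    apply emb_injective
    rw [map_smul, (T.2.2 (r • a)).choose_spec, (T.2.2 a).choose_spec]
    ext c
    change T.1 (star θ (r • a) c) = r • T.1 (star θ a c)
    rw [← map_smul]
    exact congrArg T.1 ((starRightCLM θ c).map_smul r a)

lemma emb_act (T : moyalAlgebra n θ) (a : 𝓢(Space n, ℂ)) :
    emb (act T a) = distStar θ T.1 a :=
  (T.2.2 a).choose_spec

/-- The product `R ⋆ T` of two elements of `𝓜`, by duality: `⟨R ⋆ T, a⟩ = ⟨R, T ⋆ a⟩`,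
as a linear form on `𝓢`. -/
def mul (R T : moyalAlgebra n θ) : 𝓢(Space n, ℂ) →ₗ[ℂ] ℂ :=
  R.1.toLinearMap ∘ₗ act T

/-- The Moyal bracket `[R, T] = R ⋆ T - T ⋆ R` of two elements of `𝓜`. -/
def bracket (R T : moyalAlgebra n θ) : 𝓢(Space n, ℂ) →ₗ[ℂ] ℂ := mul R T - mul T R

/-- The polynomial function on `ℝ ^ D` of a polynomial with complex coefficients. -/
def polyFun (p : MvPolynomial (Fin 2 × Fin n) ℂ) (x : Space n) : ℂ :=
  MvPolynomial.eval (fun i => (x i : ℂ)) p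

lemma hasTemperateGrowth_polyFun (p : MvPolynomial (Fin 2 × Fin n) ℂ) :
    (polyFun p).HasTemperateGrowth := by
  induction p using MvPolynomial.induction_on with
  | C c =>
    have : polyFun (n := n) (MvPolynomial.C c) = fun _ => c := by ext; simp [polyFun]
    rw [this]; exact .const c
  | add p q hp hq =>
    have : polyFun (p + q) = polyFun p + polyFun q := by ext; simp [polyFun]
    rw [this]; exact hp.add hq
  | mul_X p i hp =>
    have : polyFun (p * MvPolynomial.X i) =
        fun x => polyFun p x * (Complex.ofRealCLM ∘L EuclideanSpace.proj (𝕜 := ℝ) i) x := by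
      ext; simp [polyFun]
    rw [this]; exact hp.mul (ContinuousLinearMap.hasTemperateGrowth _)

/-- The polynomial function of `p` as a tempered distribution, `⟨p, f⟩ = ∫ f p`. -/
def polyDist : MvPolynomial (Fin 2 × Fin n) ℂ →ₗ[ℂ] 𝓢'(Space n, ℂ) where
  toFun p := (hasTemperateGrowth_polyFun p).toTemperedDistribution volume
  map_add' p q := by
    ext f
    have h (p : MvPolynomial (Fin 2 × Fin n) ℂ) : Integrable fun x : Space n => f x * polyFun p x :=
      (bilinLeftCLM (ContinuousLinearMap.mul ℂ ℂ) (hasTemperateGrowth_polyFun p) f).integrable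
    change ∫ x : Space n, f x * polyFun (p + q) x =
      (∫ x : Space n, f x * polyFun p x) + ∫ x : Space n, f x * polyFun q x
    rw [← integral_add (h p) (h q)]
    simp [polyFun, mul_add]
  map_smul' c p := by
    ext f
    change ∫ x : Space n, f x * polyFun (c • p) x = c * ∫ x : Space n, f x * polyFun p x
    rw [← integral_const_mul]
    simp [polyFun, mul_left_comm]

lemma polyDist_apply (p : MvPolynomial (Fin 2 × Fin n) ℂ) (f : 𝓢(Space n, ℂ)) :
    polyDist p f = ∫ x : Space n, f x * polyFun p x := rfl

variable (n) in
/-- The space `𝓟₂` of polynomial functions of degree at most `2`. -/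
def polyTwo : Submodule ℂ 𝓢'(Space n, ℂ) :=
  (MvPolynomial.restrictTotalDegree (Fin 2 × Fin n) ℂ 2).map polyDist

lemma polyDist_mem_polyTwo {p : MvPolynomial (Fin 2 × Fin n) ℂ} (hp : p.totalDegree ≤ 2) :
    polyDist p ∈ polyTwo n :=
  Submodule.mem_map_of_mem ((MvPolynomial.mem_restrictTotalDegree _ _ _).2 hp)

variable (θ) in
/-- The Poisson bracket `{p, q} = Θ_{μν} ∂_μ p ∂_ν q`. -/
def poisson (p q : MvPolynomial (Fin 2 × Fin n) ℂ) : MvPolynomial (Fin 2 × Fin n) ℂ :=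
  ∑ μ, ∑ ν, MvPolynomial.C ((theta n θ μ ν : ℝ) : ℂ) *
    MvPolynomial.pderiv μ p * MvPolynomial.pderiv ν q

end Algebra

end Moyal

/-! Two facts about Schwartz functions carry the proof. The integral is a trace, `∫ a ⋆ b = ∫ a b`
(`integral_star`), so the constant 1 acts as a unit. A coordinate moves through the product at the
cost of a derivative along the row `Θ_i` of `Θ`: `x_i (a ⋆ b) = (x_i a) ⋆ b - (I/2) a ⋆ ∂_{Θ_i} b`
(`coordMul_star`).

Dualising the second fact expresses `(T x_i) ⋆ a` and `a ⋆ (T x_i)` through the action of `T`.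
Starting from 1, induction puts every polynomial in the Moyal algebra, and integration by parts
gives the recursion `p ⋆ (q x_i) = (p ⋆ q) x_i - (I/2) {x_i, p} ⋆ q` (`mul_polyMoyal_mul_X`). The
Moyal expansion truncated at second order, `moyalTwo`, obeys the same recursion as long as the right
factor has degree at most two, so it computes `p ⋆ q` there (`mul_polyMoyal`).

The terms of order 0 and 2 in `Θ` are symmetric in `p` and `q`, the term of order 1 is
antisymmetric. The bracket is therefore `I` times the Poisson bracket, which preserves degree at
most two and satisfies Jacobi (`poisson_jacobi`). -/

namespace Moyal

open MeasureTheory FourierTransform SchwartzMap LineDeriv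
open scoped Matrix

/-! ### Poisson calculus on polynomials -/

noncomputable section Polynomials

variable {n : ℕ} {θ : ℝ}

lemma theta_apply_swap (n : ℕ) (θ : ℝ) (i j : Fin 2 × Fin n) : theta n θ i j = -theta n θ j i := by
  obtain ⟨a, k⟩ := i
  obtain ⟨b, l⟩ := j
  simp only [theta, sigma, Matrix.smul_apply, Matrix.blockDiagonal_apply, smul_eq_mul]
  by_cases h : k = l
  · subst h
    fin_cases a <;> fin_cases b <;> simp
  · simp [h, Ne.symm h]

variable (θ) in
/-- The Hamiltonian derivation `∑ ν, Θ i ν ∂_ν` on polynomials. -/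
def thetaDeriv (i : Fin 2 × Fin n) :
    Derivation ℂ (MvPolynomial (Fin 2 × Fin n) ℂ) (MvPolynomial (Fin 2 × Fin n) ℂ) :=
  MvPolynomial.mkDerivation ℂ fun j => MvPolynomial.C ((theta n θ i j : ℝ) : ℂ)

@[simp]
lemma thetaDeriv_X (i j : Fin 2 × Fin n) :
    thetaDeriv θ i (MvPolynomial.X j) = MvPolynomial.C ((theta n θ i j : ℝ) : ℂ) :=
  MvPolynomial.mkDerivation_X ..

/-- The commutator of two derivations is a derivation, and constant coefficients make it vanish on
every variable. -/
lemma derivation_comm_of_const {σ : Type*}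
    {D₁ D₂ : Derivation ℂ (MvPolynomial σ ℂ) (MvPolynomial σ ℂ)} {c₁ c₂ : σ → ℂ}
    (h₁ : ∀ i, D₁ (.X i) = .C (c₁ i)) (h₂ : ∀ i, D₂ (.X i) = .C (c₂ i)) (p : MvPolynomial σ ℂ) :
    D₁ (D₂ p) = D₂ (D₁ p) := by
  have h : ⁅D₁, D₂⁆ = 0 := MvPolynomial.derivation_ext fun i => by
    simp [Derivation.commutator_apply, h₁, h₂, MvPolynomial.derivation_C]
  simpa [Derivation.commutator_apply, sub_eq_zero] using congr($h p)

lemma pderiv_X_eq_C (i j : Fin 2 × Fin n) : MvPolynomial.pderiv i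
    (MvPolynomial.X j : MvPolynomial (Fin 2 × Fin n) ℂ) =
      MvPolynomial.C (if j = i then 1 else 0) := by
  rw [MvPolynomial.pderiv_X, Pi.single_apply]
  split_ifs <;> simp

lemma thetaDeriv_pderiv (i j : Fin 2 × Fin n) (p : MvPolynomial (Fin 2 × Fin n) ℂ) :
    thetaDeriv θ i (MvPolynomial.pderiv j p) = MvPolynomial.pderiv j (thetaDeriv θ i p) :=
  derivation_comm_of_const (thetaDeriv_X i) (pderiv_X_eq_C j) p

lemma thetaDeriv_thetaDeriv (i j : Fin 2 × Fin n) (p : MvPolynomial (Fin 2 × Fin n) ℂ) :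
    thetaDeriv θ i (thetaDeriv θ j p) = thetaDeriv θ j (thetaDeriv θ i p) :=
  derivation_comm_of_const (thetaDeriv_X i) (thetaDeriv_X j) p

lemma derivation_sum_apply {σ ι : Type*} (s : Finset ι)
    (D : ι → Derivation ℂ (MvPolynomial σ ℂ) (MvPolynomial σ ℂ)) (p : MvPolynomial σ ℂ) :
    (∑ i ∈ s, D i) p = ∑ i ∈ s, D i p :=
  (congrFun (map_sum Derivation.coeFnAddMonoidHom D s) p).trans (Finset.sum_apply ..)

lemma thetaDeriv_eq_sum (i : Fin 2 × Fin n) (p : MvPolynomial (Fin 2 × Fin n) ℂ) :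
    thetaDeriv θ i p =
      ∑ j, MvPolynomial.C ((theta n θ i j : ℝ) : ℂ) * MvPolynomial.pderiv j p := by
  have h : thetaDeriv θ i =
      ∑ j, (MvPolynomial.C ((theta n θ i j : ℝ) : ℂ) : MvPolynomial (Fin 2 × Fin n) ℂ) •
        MvPolynomial.pderiv j := MvPolynomial.derivation_ext fun k => by
    simp [derivation_sum_apply, MvPolynomial.pderiv_X, Pi.single_apply]
  rw [h]
  simp [derivation_sum_apply]

/-- Moving `Θ` from one factor of a contraction to the other changes the sign. -/
lemma sum_thetaDeriv_mul_pderiv (p q : MvPolynomial (Fin 2 × Fin n) ℂ) :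
    ∑ i, thetaDeriv θ i p * MvPolynomial.pderiv i q =
      -∑ i, MvPolynomial.pderiv i p * thetaDeriv θ i q := by
  simp only [thetaDeriv_eq_sum, Finset.sum_mul, Finset.mul_sum, ← Finset.sum_neg_distrib]
  rw [Finset.sum_comm]
  refine Finset.sum_congr rfl fun i _ => Finset.sum_congr rfl fun j _ => ?_
  rw [theta_apply_swap n θ j i]
  push_cast
  rw [map_neg]
  ring

lemma poisson_eq_sum (p q : MvPolynomial (Fin 2 × Fin n) ℂ) :
    poisson θ p q = ∑ i, MvPolynomial.pderiv i p * thetaDeriv θ i q := by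
  simp only [poisson, thetaDeriv_eq_sum, Finset.mul_sum]
  refine Finset.sum_congr rfl fun i _ => Finset.sum_congr rfl fun j _ => ?_
  ring

lemma poisson_swap (p q : MvPolynomial (Fin 2 × Fin n) ℂ) : poisson θ p q = -poisson θ q p := by
  rw [poisson_eq_sum, poisson_eq_sum, ← sum_thetaDeriv_mul_pderiv]
  exact Finset.sum_congr rfl fun i _ => mul_comm _ _

variable (θ) in
/-- The Hamiltonian vector field `{p, ·}` as a derivation. -/
def poissonDeriv (p : MvPolynomial (Fin 2 × Fin n) ℂ) :
    Derivation ℂ (MvPolynomial (Fin 2 × Fin n) ℂ) (MvPolynomial (Fin 2 × Fin n) ℂ) :=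
  ∑ i, MvPolynomial.pderiv i p • thetaDeriv θ i

lemma poissonDeriv_apply (p q : MvPolynomial (Fin 2 × Fin n) ℂ) :
    poissonDeriv θ p q = poisson θ p q := by
  simp [poisson_eq_sum, poissonDeriv, derivation_sum_apply]

lemma poisson_add_right (p q r : MvPolynomial (Fin 2 × Fin n) ℂ) :
    poisson θ p (q + r) = poisson θ p q + poisson θ p r := by
  simp only [← poissonDeriv_apply, map_add]

lemma poisson_smul_right (c : ℂ) (p q : MvPolynomial (Fin 2 × Fin n) ℂ) :
    poisson θ p (c • q) = c • poisson θ p q := by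
  simp only [← poissonDeriv_apply, Derivation.map_smul]

lemma poisson_mul_right (p q r : MvPolynomial (Fin 2 × Fin n) ℂ) :
    poisson θ p (q * r) = q * poisson θ p r + r * poisson θ p q := by
  simp only [← poissonDeriv_apply, Derivation.leibniz, smul_eq_mul]

lemma poisson_smul_left (c : ℂ) (p q : MvPolynomial (Fin 2 × Fin n) ℂ) :
    poisson θ (c • p) q = c • poisson θ p q := by
  rw [poisson_swap, poisson_smul_right, poisson_swap p q, smul_neg]

lemma poisson_add_left (p q r : MvPolynomial (Fin 2 × Fin n) ℂ) :
    poisson θ (p + q) r = poisson θ p r + poisson θ q r := by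
  rw [poisson_swap, poisson_add_right, poisson_swap p, poisson_swap q, neg_add]

lemma poisson_X_right (p : MvPolynomial (Fin 2 × Fin n) ℂ) (i : Fin 2 × Fin n) :
    poisson θ p (MvPolynomial.X i) = -thetaDeriv θ i p := by
  rw [poisson_swap, poisson_eq_sum]
  simp [MvPolynomial.pderiv_X, Pi.single_apply]

lemma thetaDeriv_poisson (i : Fin 2 × Fin n) (p q : MvPolynomial (Fin 2 × Fin n) ℂ) :
    thetaDeriv θ i (poisson θ p q) =
      poisson θ (thetaDeriv θ i p) q + poisson θ p (thetaDeriv θ i q) := by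
  simp only [poisson_eq_sum, map_sum, Derivation.leibniz, smul_eq_mul, ← Finset.sum_add_distrib]
  refine Finset.sum_congr rfl fun j _ => ?_
  rw [thetaDeriv_pderiv, thetaDeriv_thetaDeriv]
  ring

/-- Both sides are derivations in `r` once the last term is moved to the left, so it suffices to
take `r` a variable. Bracketing with a variable is `thetaDeriv` up to sign, and `thetaDeriv_poisson`
says that this differentiates the Poisson bracket. -/
lemma poisson_jacobi (p q r : MvPolynomial (Fin 2 × Fin n) ℂ) :
    poisson θ p (poisson θ q r) = poisson θ (poisson θ p q) r + poisson θ q (poisson θ p r) := by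
  have h : ⁅poissonDeriv θ p, poissonDeriv θ q⁆ = poissonDeriv θ (poisson θ p q) :=
    MvPolynomial.derivation_ext fun i => by
      have hneg (a b : MvPolynomial (Fin 2 × Fin n) ℂ) : poisson θ a (-b) = -poisson θ a b := by
        simp only [← poissonDeriv_apply, map_neg]
      rw [Derivation.commutator_apply]
      simp only [poissonDeriv_apply, poisson_X_right, thetaDeriv_poisson, hneg]
      rw [poisson_swap (thetaDeriv θ i p) q]
      ring
  have h' := congr($h r)
  rw [Derivation.commutator_apply] at h'
  simp only [poissonDeriv_apply] at h'
  rw [← h', sub_add_cancel]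

/-! ### The Moyal product of polynomials to second order -/

variable (θ) in
/-- The second order contraction `Θ_{μα} Θ_{νβ} ∂_α ∂_β p ∂_μ ∂_ν q`. -/
def contractTwo (p q : MvPolynomial (Fin 2 × Fin n) ℂ) : MvPolynomial (Fin 2 × Fin n) ℂ :=
  ∑ i, ∑ j, thetaDeriv θ i (thetaDeriv θ j p) * MvPolynomial.pderiv i (MvPolynomial.pderiv j q)

/-- Each of the two matrices `Θ` is moved from `p` to `q` by `sum_thetaDeriv_mul_pderiv`; the two
signs cancel. This symmetry removes the second-order term from the bracket. -/
lemma contractTwo_swap (p q : MvPolynomial (Fin 2 × Fin n) ℂ) :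
    contractTwo θ p q = contractTwo θ q p := by
  have hcomm (i j : Fin 2 × Fin n) (r : MvPolynomial (Fin 2 × Fin n) ℂ) :
      MvPolynomial.pderiv i (MvPolynomial.pderiv j r) =
        MvPolynomial.pderiv j (MvPolynomial.pderiv i r) :=
    derivation_comm_of_const (pderiv_X_eq_C i) (pderiv_X_eq_C j) r
  calc contractTwo θ p q
      = ∑ j, ∑ i, thetaDeriv θ i (thetaDeriv θ j p) *
          MvPolynomial.pderiv i (MvPolynomial.pderiv j q) := Finset.sum_comm
    _ = -∑ j, ∑ i, MvPolynomial.pderiv i (thetaDeriv θ j p) *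
          thetaDeriv θ i (MvPolynomial.pderiv j q) := by
        rw [← Finset.sum_neg_distrib]
        exact Finset.sum_congr rfl fun j _ => sum_thetaDeriv_mul_pderiv _ _
    _ = ∑ i, -∑ j, thetaDeriv θ j (MvPolynomial.pderiv i p) *
          MvPolynomial.pderiv j (thetaDeriv θ i q) := by
        rw [Finset.sum_comm, ← Finset.sum_neg_distrib]
        simp only [thetaDeriv_pderiv]
    _ = ∑ i, ∑ j, MvPolynomial.pderiv j (MvPolynomial.pderiv i p) *
          thetaDeriv θ j (thetaDeriv θ i q) := by
        refine Finset.sum_congr rfl fun i _ => ?_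
        rw [sum_thetaDeriv_mul_pderiv, neg_neg]
    _ = contractTwo θ q p := by
        refine Finset.sum_congr rfl fun i _ => Finset.sum_congr rfl fun j _ => ?_
        rw [mul_comm, hcomm, thetaDeriv_thetaDeriv]

variable (θ) in
/-- The Moyal product of polynomials up to second order in `Θ`. -/
def moyalTwo (p q : MvPolynomial (Fin 2 × Fin n) ℂ) : MvPolynomial (Fin 2 × Fin n) ℂ :=
  p * q + (Complex.I / 2) • poisson θ p q + ((Complex.I / 2) ^ 2 / 2) • contractTwo θ p q

lemma moyalTwo_add_right (p q r : MvPolynomial (Fin 2 × Fin n) ℂ) :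
    moyalTwo θ p (q + r) = moyalTwo θ p q + moyalTwo θ p r := by
  simp only [moyalTwo, contractTwo, poisson_add_right, map_add, mul_add, Finset.sum_add_distrib,
    smul_add]
  abel

lemma moyalTwo_smul_right (c : ℂ) (p q : MvPolynomial (Fin 2 × Fin n) ℂ) :
    moyalTwo θ p (c • q) = c • moyalTwo θ p q := by
  simp only [moyalTwo, contractTwo, poisson_smul_right, Derivation.map_smul, smul_add,
    mul_smul_comm, ← Finset.smul_sum, smul_comm c]

lemma moyalTwo_one_right (p : MvPolynomial (Fin 2 × Fin n) ℂ) : moyalTwo θ p 1 = p := by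
  simp [moyalTwo, contractTwo, ← poissonDeriv_apply]

lemma contractTwo_X_right (p : MvPolynomial (Fin 2 × Fin n) ℂ) (i : Fin 2 × Fin n) :
    contractTwo θ p (MvPolynomial.X i) = 0 := by
  simp only [contractTwo, pderiv_X_eq_C, MvPolynomial.pderiv_C, mul_zero, Finset.sum_const_zero]

lemma moyalTwo_X_right (p : MvPolynomial (Fin 2 × Fin n) ℂ) (i : Fin 2 × Fin n) :
    moyalTwo θ p (MvPolynomial.X i) =
      p * MvPolynomial.X i - (Complex.I / 2) • thetaDeriv θ i p := by
  simp [moyalTwo, contractTwo_X_right, poisson_X_right, sub_eq_add_neg]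

lemma contractTwo_X_mul_X (p : MvPolynomial (Fin 2 × Fin n) ℂ) (i j : Fin 2 × Fin n) :
    contractTwo θ p (MvPolynomial.X i * MvPolynomial.X j) =
      (2 : ℂ) • thetaDeriv θ i (thetaDeriv θ j p) := by
  simp only [contractTwo, Derivation.leibniz, map_add, smul_eq_mul, pderiv_X_eq_C,
    MvPolynomial.pderiv_C, mul_zero, zero_add, mul_add, Finset.sum_add_distrib]
  rw [two_smul]
  -- The second derivative of `X i * X j` is a sum of two products of Kronecker deltas; each
  -- contributes the same iterated `thetaDeriv` since these commute.
  congr 1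
  · simp [apply_ite]
  · rw [Finset.sum_comm, thetaDeriv_thetaDeriv]
    simp [apply_ite]

/-- The right-hand side has the shape that `mul_polyMoyal_mul_X` produces for the true product with
`q = X i`. -/
lemma moyalTwo_X_mul_X_right (p : MvPolynomial (Fin 2 × Fin n) ℂ) (i j : Fin 2 × Fin n) :
    moyalTwo θ p (MvPolynomial.X i * MvPolynomial.X j) =
      moyalTwo θ p (MvPolynomial.X i) * MvPolynomial.X j -
        (Complex.I / 2) • moyalTwo θ (thetaDeriv θ j p) (MvPolynomial.X i) := by
  rw [moyalTwo_X_right, moyalTwo_X_right, moyalTwo, contractTwo_X_mul_X, poisson_mul_right,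
    poisson_X_right, poisson_X_right]
  simp only [MvPolynomial.smul_eq_C_mul]
  have h : (MvPolynomial.C ((Complex.I / 2) ^ 2 / 2) * MvPolynomial.C 2 :
      MvPolynomial (Fin 2 × Fin n) ℂ) = MvPolynomial.C (Complex.I / 2) ^ 2 := by
    rw [← map_mul, ← map_pow, div_mul_cancel₀ _ two_ne_zero]
  rw [← mul_assoc _ (MvPolynomial.C 2), h]
  ring

lemma moyalTwo_sub_swap (p q : MvPolynomial (Fin 2 × Fin n) ℂ) :
    moyalTwo θ p q - moyalTwo θ q p = Complex.I • poisson θ p q := by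
  rw [moyalTwo, moyalTwo, contractTwo_swap q p, poisson_swap q p, smul_neg, mul_comm q p]
  have h : Complex.I • poisson θ p q =
      (Complex.I / 2) • poisson θ p q + (Complex.I / 2) • poisson θ p q := by
    rw [← add_smul, add_halves]
  rw [h]
  abel

/-- Induction over polynomials of degree at most two. -/
lemma induction_totalDegree_le_two {σ : Type*} {M : MvPolynomial σ ℂ → Prop}
    (add : ∀ p q, M p → M q → M (p + q)) (smul : ∀ (c : ℂ) p, M p → M (c • p)) (one : M 1)
    (X : ∀ i, M (.X i)) (X_mul_X : ∀ i j, M (.X i * .X j)) {p : MvPolynomial σ ℂ}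
    (hp : p.totalDegree ≤ 2) : M p := by
  have zero : M 0 := by simpa using smul 0 1 one
  have hmon (s : σ →₀ ℕ) (hs : s.sum (fun _ e => e) ≤ 2) (c : ℂ) :
      M (MvPolynomial.monomial s c) := by
    suffices h : M (MvPolynomial.monomial s 1) by
      simpa [MvPolynomial.smul_monomial] using smul c _ h
    -- One variable is peeled off a nonconstant monomial. A third peeling would contradict the
    -- degree bound, so two suffice.
    have split (t : σ →₀ ℕ) (ht : t ≠ 0) : ∃ i u, t = u + Finsupp.single i 1 ∧
        t.sum (fun _ e => e) = u.sum (fun _ e => e) + 1 := by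
      classical
      obtain ⟨i, hi⟩ := Finsupp.ne_iff.1 ht
      have hle : Finsupp.single i 1 ≤ t := by
        rw [Finsupp.single_le_iff]
        exact Nat.one_le_iff_ne_zero.2 hi
      refine ⟨i, t - Finsupp.single i 1, (tsub_add_cancel_of_le hle).symm, ?_⟩
      conv_lhs => rw [← tsub_add_cancel_of_le hle]
      rw [Finsupp.sum_add_index' (by simp) (by simp)]
      simp
    by_cases h0 : s = 0
    · subst h0
      exact one
    obtain ⟨i, u, rfl, hu⟩ := split s h0
    rw [hu] at hs
    by_cases h1 : u = 0
    · subst h1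
      rw [zero_add]
      exact X i
    obtain ⟨j, v, rfl, hv⟩ := split u h1
    have hv0 : v = 0 := by
      by_contra h2
      obtain ⟨k, w, rfl, hw⟩ := split v h2
      omega
    subst hv0
    have := X_mul_X j i
    rwa [MvPolynomial.X, MvPolynomial.X, MvPolynomial.monomial_mul, one_mul,
      ← zero_add (Finsupp.single j 1)] at this
  rw [p.as_sum]
  refine Finset.sum_induction _ M add zero fun s hs => hmon s ?_ _
  exact (MvPolynomial.le_totalDegree hs).trans hp

lemma totalDegree_pderiv_le {σ : Type*} (i : σ) (p : MvPolynomial σ ℂ) :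
    (MvPolynomial.pderiv i p).totalDegree ≤ p.totalDegree - 1 := by
  refine Finset.sup_le fun s hs => ?_
  rw [MvPolynomial.mem_support_iff, MvPolynomial.coeff_pderiv] at hs
  have h := MvPolynomial.le_totalDegree (MvPolynomial.mem_support_iff.2 (left_ne_zero_of_mul hs))
  rw [Finsupp.sum_add_index' (by simp) (by simp)] at h
  simp only [Finsupp.sum_single_index] at h
  omega

/-- Each factor loses one degree by differentiation, leaving at most 1 + 1. This is why degree two
is preserved. -/
lemma totalDegree_poisson_le {p q : MvPolynomial (Fin 2 × Fin n) ℂ} (hp : p.totalDegree ≤ 2)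
    (hq : q.totalDegree ≤ 2) : (poisson θ p q).totalDegree ≤ 2 := by
  refine MvPolynomial.totalDegree_finsetSum_le fun i _ =>
    MvPolynomial.totalDegree_finsetSum_le fun j _ => ?_
  refine (MvPolynomial.totalDegree_mul _ _).trans ?_
  have h1 := MvPolynomial.totalDegree_mul (MvPolynomial.C ((theta n θ i j : ℝ) : ℂ))
    (MvPolynomial.pderiv i p)
  rw [MvPolynomial.totalDegree_C] at h1
  have h2 := totalDegree_pderiv_le i p
  have h3 := totalDegree_pderiv_le j q
  omega

end Polynomials

/-! ### Coordinates and the trace for the Moyal product of Schwartz functions -/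

noncomputable section StarProduct

variable {n : ℕ} {θ : ℝ}

lemma transpose_theta (n : ℕ) (θ : ℝ) : (theta n θ)ᵀ = -theta n θ :=
  Matrix.ext fun i j => theta_apply_swap n θ j i

variable (θ) in
/-- The `i`-th row of `Θ` as a vector. -/
def thetaVec (i : Fin 2 × Fin n) : Space n := WithLp.toLp 2 (theta n θ i)

/-- By antisymmetry the row `Θ_i` is `-Θ e_i`, and the inverse matrix in `invEquiv` cancels `Θ`. -/
lemma inner_invEquiv_thetaVec (hθ : θ ≠ 0) (i : Fin 2 × Fin n) (y : Space n) :
    inner ℝ (invEquiv n hθ y) (thetaVec θ i) = -y i := by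
  have h : (thetaVec θ i).ofLp = -(theta n θ *ᵥ Pi.single i 1) := by
    ext j
    simp [thetaVec, theta_apply_swap n θ i j]
  rw [real_inner_comm, inner_invEquiv, h, Matrix.mulVec_neg, Matrix.mulVec_mulVec,
    mul_eq_one_comm.1 (theta_mul_inv hθ), Matrix.one_mulVec]
  simp

/-- The inverse of `Θ` is antisymmetric. In `integral_star` this makes the phase invariant under `x
↦ x - y`. -/
lemma inner_invEquiv_self (hθ : θ ≠ 0) (y : Space n) : inner ℝ y (invEquiv n hθ y) = 0 := by
  have hneg : (-theta n θ)⁻¹ = -(theta n θ)⁻¹ :=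
    Matrix.inv_eq_right_inv (by rw [neg_mul_neg, theta_mul_inv hθ])
  have h : inner ℝ y (invEquiv n hθ y) = -inner ℝ y (invEquiv n hθ y) := by
    conv_rhs => rw [inner_invEquiv, Matrix.dotProduct_mulVec, ← Matrix.mulVec_transpose,
      Matrix.transpose_nonsing_inv, transpose_theta, hneg, Matrix.neg_mulVec,
      neg_dotProduct, neg_neg, dotProduct_comm]
    exact inner_invEquiv hθ y y
  linarith

lemma det_theta (n : ℕ) (θ : ℝ) : (theta n θ).det = θ ^ (2 * n) := by
  rw [theta, Matrix.det_smul, sigma, Matrix.det_blockDiagonal]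
  simp [Matrix.det_fin_two]

lemma det_invEquiv (hθ : θ ≠ 0) :
    LinearMap.det ((invEquiv n hθ : Space n →L[ℝ] Space n) : Space n →ₗ[ℝ] Space n) =
      (θ ^ (2 * n))⁻¹ := by
  change LinearMap.det (Matrix.toLpLin 2 2 ((theta n θ)⁻¹)ᵀ) = _
  rw [LinearMap.det_toLpLin, Matrix.det_transpose, Matrix.det_nonsing_inv, det_theta,
    Ring.inverse_eq_inv']

/-- The change of variables `w = A y / π`. -/
lemma integral_comp_smul_invEquiv (hθ : θ ≠ 0) (h : Space n → ℂ) :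
    ∫ y, h (Real.pi⁻¹ • invEquiv n hθ y) = (((Real.pi * θ) ^ (2 * n) : ℝ) : ℂ) * ∫ w, h w := by
  have hdet : LinearMap.det ((invEquiv n hθ : Space n →L[ℝ] Space n) : Space n →ₗ[ℝ] Space n) ≠ 0 :=
    by rw [det_invEquiv]; positivity
  have hmap := Measure.map_linearMap_addHaar_eq_smul_addHaar (volume : Measure (Space n)) hdet
  -- The exponent is even, so the absolute value of the Jacobian drops also for negative `θ`.
  have hθ2 : 0 ≤ θ ^ (2 * n) := by rw [pow_mul]; positivity
  have h1 := (invEquiv n hθ).toHomeomorph.measurableEmbedding.integral_map (μ := volume)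
    fun w => h (Real.pi⁻¹ • w)
  change _ = ∫ y, h (Real.pi⁻¹ • invEquiv n hθ y) at h1
  rw [← h1]
  change ∫ w, h (Real.pi⁻¹ • w) ∂(Measure.map
    ((invEquiv n hθ : Space n →L[ℝ] Space n) : Space n →ₗ[ℝ] Space n) volume) = _
  rw [hmap, integral_smul_measure, Measure.integral_comp_smul, det_invEquiv, inv_inv,
    abs_of_nonneg hθ2, ENNReal.toReal_ofReal hθ2, smul_smul, Complex.real_smul]
  congr 2
  rw [finrank_euclideanSpace, abs_of_nonneg (by positivity), inv_pow, inv_inv, Fintype.card_prod,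
    Fintype.card_fin, Fintype.card_fin, mul_pow, mul_comm]

/-- The Schwartz function `(y, x) ↦ exp (2 i ⟪x, A y⟫) a (x + y) 𝓕 b (A y / π)` whose
marginal is the Moyal product. -/
def starKernel (hθ : θ ≠ 0) (a b : 𝓢(Space n, ℂ)) : 𝓢(WithLp 2 (Space n × Space n), ℂ) :=
  smulLeftCLM ℂ (phase (invEquiv n hθ)) (compCLMOfContinuousLinearEquiv ℂ (shear (Space n))
    (tensorCLM a (scaledFourierCLM (invEquiv n hθ) b)))

lemma starKernel_apply (hθ : θ ≠ 0) (a b : 𝓢(Space n, ℂ)) (x y : Space n) :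
    starKernel hθ a b (WithLp.toLp 2 (y, x)) = phase (invEquiv n hθ) (WithLp.toLp 2 (y, x)) *
      (a (x + y) * scaledFourierCLM (invEquiv n hθ) b y) := by
  rw [starKernel, smulLeftCLM_apply_apply (hasTemperateGrowth_phase _)]
  rfl

/-- The phase has modulus one and `a` is bounded, so the Schwartz factor in `y` decides. -/
lemma integrable_starKernel (hθ : θ ≠ 0) (a b : 𝓢(Space n, ℂ)) (x : Space n) :
    Integrable fun y => starKernel hθ a b (WithLp.toLp 2 (y, x)) := by
  have h2 : Integrable fun y => scaledFourierCLM (invEquiv n hθ) b y :=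
    (scaledFourierCLM (invEquiv n hθ) b).integrable
  refine (h2.bdd_mul (c := SchwartzMap.seminorm ℂ 0 0 a)
    (f := fun y => phase (invEquiv n hθ) (WithLp.toLp 2 (y, x)) * a (x + y)) ?_ ?_).congr ?_
  · have h3 := (hasTemperateGrowth_phase (invEquiv n hθ)).1.continuous
    have h4 := a.continuous
    exact Continuous.aestronglyMeasurable (by fun_prop)
  · refine Filter.Eventually.of_forall fun y => ?_
    rw [norm_mul, phase_apply, mul_comm Complex.I, Complex.norm_exp_ofReal_mul_I, one_mul]
    exact norm_le_seminorm ℂ a _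
  · exact Filter.Eventually.of_forall fun y => by simp only [starKernel_apply]; ring

/-- The Fourier transform turns the derivative into the factor `2πI ⟪ξ, Θ_i⟫`. At `ξ = A y / π` this
is `-2I y_i`, so the row `Θ_i` is the direction dual to the coordinate `y_i`. -/
lemma scaledFourierCLM_lineDerivOp (hθ : θ ≠ 0) (b : 𝓢(Space n, ℂ)) (i : Fin 2 × Fin n)
    (y : Space n) : scaledFourierCLM (invEquiv n hθ) (∂_{thetaVec θ i} b) y =
      -(2 * Complex.I) * (y i * scaledFourierCLM (invEquiv n hθ) b y) := by
  change (𝓕 (∂_{thetaVec θ i} b) : 𝓢(Space n, ℂ)) (Real.pi⁻¹ • invEquiv n hθ y) =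
    -(2 * Complex.I) * (y i * (𝓕 b : 𝓢(Space n, ℂ)) (Real.pi⁻¹ • invEquiv n hθ y))
  have h : (fun ξ : Space n => inner ℝ ξ (thetaVec θ i)).HasTemperateGrowth := by fun_prop
  rw [fourier_lineDerivOp_eq, smul_apply, smulLeftCLM_apply_apply h, inner_smul_left,
    inner_invEquiv_thetaVec]
  have hpi : (Real.pi : ℂ) ≠ 0 := by exact_mod_cast Real.pi_ne_zero
  simp only [smul_eq_mul, Complex.real_smul]
  push_cast
  simp
  field_simp

/-- Multiplication of a Schwartz function by the `i`-th coordinate. -/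
def coordMul (i : Fin 2 × Fin n) : 𝓢(Space n, ℂ) →L[ℂ] 𝓢(Space n, ℂ) :=
  smulLeftCLM ℂ fun x : Space n => (x i : ℂ)

lemma coordMul_apply (i : Fin 2 × Fin n) (f : 𝓢(Space n, ℂ)) (x : Space n) :
    coordMul i f x = x i * f x :=
  smulLeftCLM_apply_apply
    (Complex.ofRealCLM ∘L EuclideanSpace.proj (𝕜 := ℝ) i).hasTemperateGrowth f x

lemma lineDerivOp_coordMul (v : Space n) (i : Fin 2 × Fin n) (f : 𝓢(Space n, ℂ)) :
    ∂_{v} (coordMul i f) = coordMul i (∂_{v} f) + (v i : ℂ) • f := by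
  ext x
  have h := ((Complex.ofRealCLM ∘L EuclideanSpace.proj (𝕜 := ℝ) i).hasFDerivAt (x := x)).mul
    (f.hasFDerivAt x)
  have h' : (coordMul i f : Space n → ℂ) =
      (Complex.ofRealCLM ∘L EuclideanSpace.proj (𝕜 := ℝ) i) * f := by
    ext y; exact coordMul_apply i f y
  simp only [add_apply, smul_apply, coordMul_apply,
    lineDerivOp_apply_eq_fderiv]
  rw [h', h.fderiv]
  simp [mul_comm]

variable [NeZero θ]

lemma star_apply (a b : 𝓢(Space n, ℂ)) (x : Space n) :
    star θ a b x = (((Real.pi * θ) ^ (2 * n) : ℝ) : ℂ)⁻¹ *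
      ∫ y, starKernel (NeZero.ne θ) a b (WithLp.toLp 2 (y, x)) := by
  rw [star_eq_left, ← marginalCLM_apply]
  rfl

/-- Multiplication by a coordinate in terms of the Moyal product. -/
lemma coordMul_star (i : Fin 2 × Fin n) (a b : 𝓢(Space n, ℂ)) :
    coordMul i (star θ a b) =
      star θ (coordMul i a) b - (Complex.I / 2) • star θ a (∂_{thetaVec θ i} b) := by
  ext x
  rw [coordMul_apply, sub_apply, smul_apply, star_apply, star_apply,
    star_apply, smul_eq_mul, mul_left_comm, mul_left_comm (Complex.I / 2), ← mul_sub]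
  congr 1
  rw [← integral_const_mul, ← integral_const_mul, ← integral_sub (integrable_starKernel ..)
      ((integrable_starKernel ..).const_mul _)]
  congr 1
  ext y
  -- Under the integral `x_i = (x_i + y_i) - y_i`: the bracket is the coordinate of the argument of
  -- `a`, and `y_i` is absorbed as a derivative of `b`.
  simp only [starKernel_apply, coordMul_apply, scaledFourierCLM_lineDerivOp, PiLp.add_apply]
  push_cast
  linear_combination -(phase (invEquiv n (NeZero.ne θ)) (WithLp.toLp 2 (y, x)) * (y i : ℂ) * a (x + y)
    * scaledFourierCLM (invEquiv n (NeZero.ne θ)) b y) * Complex.I_sq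

/-- The integral is a trace for the Moyal product. -/
lemma integral_star (a b : 𝓢(Space n, ℂ)) : ∫ x, star θ a b x = ∫ x, a x * b x := by
  have hθ : θ ≠ 0 := NeZero.ne θ
  set A := invEquiv n hθ with hA
  set g := scaledFourierCLM A b with hg
  have hphase (x y : Space n) :
      phase A (WithLp.toLp 2 (y, x - y)) = phase A (WithLp.toLp 2 (y, x)) := by
    rw [phase_apply, phase_apply, inner_sub_left, hA, inner_invEquiv_self, sub_zero]
  -- In the variable `w = A y / π` the phase is `exp (2πI ⟪w, x⟫)`, so this is Fourier inversion for
  -- `b`; the Jacobian is the constant that normalises `⋆`.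
  have hinv (x : Space n) : ∫ y, phase A (WithLp.toLp 2 (y, x)) * g y =
      (((Real.pi * θ) ^ (2 * n) : ℝ) : ℂ) * b x := by
    have h1 : (𝓕⁻ (𝓕 b) : 𝓢(Space n, ℂ)) x = b x := by rw [fourierInv_fourier_eq]
    rw [SchwartzMap.fourierInv_coe, Real.fourierInv_eq] at h1
    rw [← h1, ← integral_comp_smul_invEquiv hθ]
    refine integral_congr_ae (Filter.Eventually.of_forall fun y => ?_)
    change phase A (WithLp.toLp 2 (y, x)) * (𝓕 b : 𝓢(Space n, ℂ)) (Real.pi⁻¹ • A y) =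
      Real.fourierChar (inner ℝ (Real.pi⁻¹ • A y) x) •
      (𝓕 b : 𝓢(Space n, ℂ)) (Real.pi⁻¹ • A y)
    rw [Circle.smul_def, smul_eq_mul, Real.fourierChar_apply, phase_apply, inner_smul_left,
      real_inner_comm]
    have hpi : (Real.pi : ℂ) ≠ 0 := by exact_mod_cast Real.pi_ne_zero
    congr 2
    push_cast
    simp
    field_simp
  have hprod : Integrable (fun p : Space n × Space n =>
      phase A (WithLp.toLp 2 p) * (g p.1 * a p.2)) (volume.prod volume) := by
    refine (integrable_prod (smulLeftCLM ℂ (phase A) (tensorCLM g a))).congr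
      (Filter.Eventually.of_forall fun p => ?_)
    dsimp only
    rw [smulLeftCLM_apply_apply (hasTemperateGrowth_phase _)]
    rfl
  simp_rw [star_apply]
  rw [integral_const_mul, integral_integral_swap
    (f := fun x y => starKernel (NeZero.ne θ) a b (WithLp.toLp 2 (y, x)))
    (integrable_prod (starKernel hθ a b)).swap]
  -- The translation `x ↦ x - y` frees `a` of `y` and leaves the phase unchanged, so the
  -- `y`-integral becomes the one in `hinv`.
  have h2 (y : Space n) : ∫ x, starKernel (NeZero.ne θ) a b (WithLp.toLp 2 (y, x)) =
      ∫ x, phase A (WithLp.toLp 2 (y, x)) * (g y * a x) := by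
    rw [← integral_sub_right_eq_self _ y]
    refine integral_congr_ae (Filter.Eventually.of_forall fun x => ?_)
    simp only [starKernel_apply, sub_add_cancel]
    rw [hphase]
    ring
  simp_rw [h2]
  rw [integral_integral_swap hprod]
  have h3 (x : Space n) : ∫ y, phase A (WithLp.toLp 2 (y, x)) * (g y * a x) =
      (((Real.pi * θ) ^ (2 * n) : ℝ) : ℂ) * (a x * b x) := by
    simp_rw [← mul_assoc]
    rw [integral_mul_const, hinv]
    ring
  simp_rw [h3]
  rw [integral_const_mul, inv_mul_cancel_left₀]
  have : Real.pi ≠ 0 := Real.pi_ne_zero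
  exact_mod_cast pow_ne_zero _ (mul_ne_zero this hθ)

end StarProduct

/-! ### Polynomials as elements of the Moyal algebra and their products -/

noncomputable section Multipliers

variable {n : ℕ} {θ : ℝ}

lemma emb_apply (f g : 𝓢(Space n, ℂ)) : emb f g = ∫ x, g x * f x :=
  toTemperedDistributionCLM_apply_apply volume f g

lemma polyDist_one_apply (f : 𝓢(Space n, ℂ)) : polyDist 1 f = ∫ x, f x := by
  simp [polyDist_apply, polyFun]

lemma polyDist_mul_X (p : MvPolynomial (Fin 2 × Fin n) ℂ) (i : Fin 2 × Fin n)
    (f : 𝓢(Space n, ℂ)) : polyDist (p * MvPolynomial.X i) f = polyDist p (coordMul i f) := by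
  simp only [polyDist_apply, coordMul_apply]
  refine integral_congr_ae (Filter.Eventually.of_forall fun x => ?_)
  simp only [polyFun, map_mul, MvPolynomial.eval_X]
  ring

/-- The integral is the Fourier transform at `ξ = 0`, where the factor `⟪ξ, v⟫` of a derivative
vanishes. -/
lemma integral_lineDerivOp (v : Space n) (f : 𝓢(Space n, ℂ)) : ∫ x, (∂_{v} f) x = 0 := by
  have h := congr($(fourier_lineDerivOp_eq f v) 0)
  have ht : (fun ξ : Space n => inner ℝ ξ v).HasTemperateGrowth := by fun_prop
  rw [smul_apply, smulLeftCLM_apply_apply ht, fourier_coe, Real.fourier_eq] at h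
  simpa using h

/-- Integration by parts against polynomials. -/
lemma polyDist_lineDerivOp (i : Fin 2 × Fin n) (p : MvPolynomial (Fin 2 × Fin n) ℂ)
    (f : 𝓢(Space n, ℂ)) :
    polyDist p (∂_{thetaVec θ i} f) = -polyDist (thetaDeriv θ i p) f := by
  -- Each variable of `p` is transferred to `f`, which stays Schwartz; hence `f` must vary. The
  -- constant case is the vanishing integral of a derivative.
  induction p using MvPolynomial.induction_on generalizing f with
  | C c =>
    have h : (MvPolynomial.C c : MvPolynomial (Fin 2 × Fin n) ℂ) = c • 1 := by
      rw [MvPolynomial.smul_eq_C_mul, mul_one]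
    have h1 : polyDist (c • (1 : MvPolynomial (Fin 2 × Fin n) ℂ)) (∂_{thetaVec θ i} f) =
        c • polyDist (1 : MvPolynomial (Fin 2 × Fin n) ℂ) (∂_{thetaVec θ i} f) := by
      rw [map_smul]; rfl
    rw [MvPolynomial.derivation_C, h, h1, polyDist_one_apply, integral_lineDerivOp, map_zero]
    simp
  | add p q hp hq =>
    rw [map_add, map_add, map_add]
    change polyDist p (∂_{thetaVec θ i} f) + polyDist q (∂_{thetaVec θ i} f) =
      -(polyDist (thetaDeriv θ i p) f + polyDist (thetaDeriv θ i q) f)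
    rw [hp, hq, neg_add]
  | mul_X p j hp =>
    have h : coordMul j (∂_{thetaVec θ i} f) =
        ∂_{thetaVec θ i} (coordMul j f) - ((theta n θ i j : ℝ) : ℂ) • f := by
      rw [lineDerivOp_coordMul]
      exact (add_sub_cancel_right _ _).symm
    have h1 : polyDist (p * MvPolynomial.C ((theta n θ i j : ℝ) : ℂ)) f =
        ((theta n θ i j : ℝ) : ℂ) • polyDist p f := by
      rw [mul_comm, ← MvPolynomial.smul_eq_C_mul, map_smul]; rfl
    rw [polyDist_mul_X, h, map_sub, hp, Derivation.leibniz, map_add, thetaDeriv_X, map_smul,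
      smul_eq_mul, smul_eq_mul, smul_eq_mul, mul_comm (MvPolynomial.X j)]
    change _ = -(polyDist (p * MvPolynomial.C ((theta n θ i j : ℝ) : ℂ)) f +
      polyDist (thetaDeriv θ i p * MvPolynomial.X j) f)
    rw [polyDist_mul_X, h1]
    ring

lemma emb_lineDerivOp (v : Space n) (f g : 𝓢(Space n, ℂ)) : emb f (∂_{v} g) = -emb (∂_{v} f) g := by
  simp only [emb_apply, mul_comm _ (f _), mul_comm _ ((∂_{v} f) _)]
  exact integral_mul_lineDerivOp_right_eq_neg_left f g v

lemma emb_coordMul (i : Fin 2 × Fin n) (f g : 𝓢(Space n, ℂ)) :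
    emb f (coordMul i g) = emb (coordMul i f) g := by
  simp only [emb_apply, coordMul_apply]
  refine integral_congr_ae (Filter.Eventually.of_forall fun x => ?_)
  ring

variable [NeZero θ]

/-- The trace property, read by duality, makes the constant 1 a unit: the start of the induction
over polynomials. -/
lemma emb_distStar_one (a : 𝓢(Space n, ℂ)) : emb a = distStar θ (polyDist 1) a := by
  ext b
  rw [distStar_apply, polyDist_one_apply, integral_star, emb_apply]
  simp only [mul_comm]

lemma emb_starDist_one (a : 𝓢(Space n, ℂ)) : emb a = starDist θ a (polyDist 1) := by
  ext b
  rw [starDist_apply, polyDist_one_apply, integral_star, emb_apply]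

/-- Right multiplication by `x_i`: the formula for `(T x_i) ⋆ a`. -/
lemma emb_distStar_mul_coord {T T' : 𝓢'(Space n, ℂ)} {i : Fin 2 × Fin n}
    (hT : ∀ f, T' f = T (coordMul i f)) {a f g : 𝓢(Space n, ℂ)}
    (hf : emb f = distStar θ T (coordMul i a)) (hg : emb g = distStar θ T a) :
    emb (f + (Complex.I / 2) • ∂_{thetaVec θ i} g) = distStar θ T' a := by
  ext b
  have h1 := congr($hf b)
  have h2 := congr($hg (∂_{thetaVec θ i} b))
  rw [distStar_apply] at h1 h2 ⊢
  rw [hT, coordMul_star, map_sub, map_smul, ← h1, ← h2, emb_lineDerivOp, map_add, map_smul]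
  change emb f b + (Complex.I / 2) • emb (∂_{thetaVec θ i} g) b = _
  rw [smul_neg, sub_neg_eq_add]

/-- The formula for `a ⋆ (T x_i)`. -/
lemma emb_starDist_mul_coord {T T' : 𝓢'(Space n, ℂ)} {i : Fin 2 × Fin n}
    (hT : ∀ f, T' f = T (coordMul i f)) {a f g : 𝓢(Space n, ℂ)}
    (hf : emb f = starDist θ a T) (hg : emb g = starDist θ (∂_{thetaVec θ i} a) T) :
    emb (coordMul i f - (Complex.I / 2) • g) = starDist θ a T' := by
  ext b
  have h1 := congr($hf (coordMul i b))
  have h2 := congr($hg b)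
  rw [starDist_apply] at h1 h2 ⊢
  rw [hT, coordMul_star, map_sub T, map_smul T, ← h1, ← h2, emb_coordMul, map_sub, map_smul]
  rfl

/-- Here `T'` is `x_i T`. Both actions of `T'` on `a` are built from actions of `T` by coordinate
multiplications and derivatives, which preserve Schwartz functions. -/
lemma mem_moyalAlgebra_of_coordMul {T T' : 𝓢'(Space n, ℂ)} {i : Fin 2 × Fin n}
    (hT : ∀ f, T' f = T (coordMul i f)) (h : T ∈ moyalAlgebra n θ) : T' ∈ moyalAlgebra n θ := by
  refine ⟨fun a => ?_, fun a => ?_⟩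
  · obtain ⟨f, hf⟩ := h.1 a
    obtain ⟨g, hg⟩ := h.1 (∂_{thetaVec θ i} a)
    exact ⟨_, emb_starDist_mul_coord hT hf hg⟩
  · obtain ⟨f, hf⟩ := h.2 (coordMul i a)
    obtain ⟨g, hg⟩ := h.2 a
    exact ⟨_, emb_distStar_mul_coord hT hf hg⟩

/-- Every polynomial function belongs to the Moyal algebra. -/
lemma polyDist_mem_moyalAlgebra (p : MvPolynomial (Fin 2 × Fin n) ℂ) :
    polyDist p ∈ moyalAlgebra n θ := by
  induction p using MvPolynomial.induction_on with
  | C c =>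
    have h : (MvPolynomial.C c : MvPolynomial (Fin 2 × Fin n) ℂ) = c • 1 := by
      rw [MvPolynomial.smul_eq_C_mul, mul_one]
    rw [h, map_smul]
    exact Submodule.smul_mem _ c ⟨fun a => ⟨a, emb_starDist_one a⟩, fun a => ⟨a, emb_distStar_one a⟩⟩
  | add p q hp hq => rw [map_add]; exact Submodule.add_mem _ hp hq
  | mul_X p i hp => exact mem_moyalAlgebra_of_coordMul (polyDist_mul_X p i) hp

/-- Injectivity of `emb` makes the choice in `act` irrelevant: any Schwartz representative is the
action. -/
lemma act_eq {T : moyalAlgebra n θ} {a f : 𝓢(Space n, ℂ)} (h : emb f = distStar θ T.1 a) :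
    act T a = f :=
  emb_injective ((emb_act T a).trans h.symm)

lemma act_add (S T : moyalAlgebra n θ) : act (S + T) = act S + act T := by
  ext1 a
  refine act_eq ?_
  rw [LinearMap.add_apply, map_add, emb_act, emb_act]
  rfl

lemma act_smul (c : ℂ) (T : moyalAlgebra n θ) : act (c • T) = c • act T := by
  ext1 a
  refine act_eq ?_
  rw [LinearMap.smul_apply, map_smul, emb_act]
  rfl

lemma mul_add_right (R S T : moyalAlgebra n θ) : mul R (S + T) = mul R S + mul R T := by
  rw [mul, act_add, LinearMap.comp_add]
  rfl

lemma mul_smul_right (c : ℂ) (R T : moyalAlgebra n θ) : mul R (c • T) = c • mul R T := by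
  rw [mul, act_smul, LinearMap.comp_smul]
  rfl

variable (θ) in
/-- Polynomials as elements of the Moyal algebra. -/
def polyMoyal : MvPolynomial (Fin 2 × Fin n) ℂ →ₗ[ℂ] moyalAlgebra n θ :=
  polyDist.codRestrict _ polyDist_mem_moyalAlgebra

lemma act_polyMoyal_one (a : 𝓢(Space n, ℂ)) : act (polyMoyal θ 1) a = a :=
  act_eq (emb_distStar_one a)

lemma act_polyMoyal_mul_X (p : MvPolynomial (Fin 2 × Fin n) ℂ) (i : Fin 2 × Fin n)
    (a : 𝓢(Space n, ℂ)) : act (polyMoyal θ (p * MvPolynomial.X i)) a =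
      act (polyMoyal θ p) (coordMul i a) +
        (Complex.I / 2) • ∂_{thetaVec θ i} (act (polyMoyal θ p) a) :=
  act_eq (emb_distStar_mul_coord (polyDist_mul_X p i) (emb_act _ _) (emb_act _ _))

lemma mul_polyMoyal_apply (p : MvPolynomial (Fin 2 × Fin n) ℂ) (T : moyalAlgebra n θ)
    (a : 𝓢(Space n, ℂ)) : mul (polyMoyal θ p) T a = polyDist p (act T a) := rfl

/-- If `p ⋆ q` and `{x_i, p} ⋆ q` are polynomials, then so is `p ⋆ (q x_i)`. -/
lemma mul_polyMoyal_mul_X {p q r s : MvPolynomial (Fin 2 × Fin n) ℂ} {i : Fin 2 × Fin n}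
    (hr : mul (polyMoyal θ p) (polyMoyal θ q) = (polyDist r).toLinearMap)
    (hs : mul (polyMoyal θ (thetaDeriv θ i p)) (polyMoyal θ q) = (polyDist s).toLinearMap) :
    mul (polyMoyal θ p) (polyMoyal θ (q * MvPolynomial.X i)) =
      (polyDist (r * MvPolynomial.X i - (Complex.I / 2) • s)).toLinearMap := by
  ext1 a
  have h1 := congr($hr (coordMul i a))
  have h2 := congr($hs a)
  rw [mul_polyMoyal_apply] at h1 h2 ⊢
  rw [act_polyMoyal_mul_X, map_add, map_smul, h1, polyDist_lineDerivOp, h2, map_sub, map_smul]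
  change polyDist r (coordMul i a) + (Complex.I / 2) • -polyDist s a =
    polyDist (r * MvPolynomial.X i) a - (Complex.I / 2) • polyDist s a
  rw [polyDist_mul_X, smul_neg, sub_eq_add_neg]

/-- The Moyal product of a polynomial with a polynomial of degree at most two. -/
lemma mul_polyMoyal {q : MvPolynomial (Fin 2 × Fin n) ℂ} (hq : q.totalDegree ≤ 2)
    (p : MvPolynomial (Fin 2 × Fin n) ℂ) :
    mul (polyMoyal θ p) (polyMoyal θ q) = (polyDist (moyalTwo θ p q)).toLinearMap := by
  have one (p : MvPolynomial (Fin 2 × Fin n) ℂ) :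
      mul (polyMoyal θ p) (polyMoyal θ 1) = (polyDist (moyalTwo θ p 1)).toLinearMap := by
    ext1 a
    rw [mul_polyMoyal_apply, act_polyMoyal_one, moyalTwo_one_right]
    rfl
  have X (i : Fin 2 × Fin n) (p : MvPolynomial (Fin 2 × Fin n) ℂ) :
      mul (polyMoyal θ p) (polyMoyal θ (MvPolynomial.X i)) =
        (polyDist (moyalTwo θ p (MvPolynomial.X i))).toLinearMap := by
    have h := mul_polyMoyal_mul_X (i := i) (one p) (one (thetaDeriv θ i p))
    rwa [one_mul, moyalTwo_one_right, moyalTwo_one_right, ← moyalTwo_X_right] at h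
  -- The left factor is quantified inside the motive because the recursion replaces `p` by
  -- `thetaDeriv θ i p`.
  refine induction_totalDegree_le_two (M := fun q => ∀ p, mul (polyMoyal θ p) (polyMoyal θ q) =
    (polyDist (moyalTwo θ p q)).toLinearMap) (fun q r hq hr p => ?_) (fun c q hq p => ?_) one X
    (fun i j p => ?_) hq p
  · rw [map_add, mul_add_right, hq, hr, moyalTwo_add_right, map_add]
    rfl
  · rw [map_smul, mul_smul_right, hq, moyalTwo_smul_right, map_smul]
    rfl
  · rw [mul_polyMoyal_mul_X (X i p) (X i (thetaDeriv θ j p)), moyalTwo_X_mul_X_right]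

/-- On polynomials of degree at most two the Moyal bracket is `i` times the Poisson bracket. -/
lemma bracket_polyMoyal {p q : MvPolynomial (Fin 2 × Fin n) ℂ} (hp : p.totalDegree ≤ 2)
    (hq : q.totalDegree ≤ 2) : bracket (polyMoyal θ p) (polyMoyal θ q) =
      (polyDist (Complex.I • poisson θ p q)).toLinearMap := by
  rw [bracket, mul_polyMoyal hq, mul_polyMoyal hp, ← moyalTwo_sub_swap, map_sub]
  rfl

end Multipliers

/-! ### The Lie algebra of polynomials of degree at most two -/

noncomputable section LieAlgebra

variable {n : ℕ} {θ : ℝ} [NeZero θ]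

variable (n θ) in
lemma polyTwo_le_moyalAlgebra : polyTwo n ≤ moyalAlgebra n θ := by
  rintro _ ⟨p, -, rfl⟩
  exact polyDist_mem_moyalAlgebra p

variable (n) in
/-- Polynomials of degree at most two as elements of `𝓟₂`. -/
def toPolyTwo (p : MvPolynomial.restrictTotalDegree (Fin 2 × Fin n) ℂ 2) : polyTwo n :=
  ⟨polyDist p.1, Submodule.mem_map_of_mem p.2⟩

/-- The Lie identities are checked on polynomial representatives, so surjectivity is enough and
injectivity of `polyDist` plays no role. -/
lemma toPolyTwo_surjective : Function.Surjective (toPolyTwo n) := by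
  rintro ⟨_, p, hp, rfl⟩
  exact ⟨⟨p, hp⟩, rfl⟩

variable (θ) in
/-- `i` times the Poisson bracket on polynomials of degree at most two. -/
def poissonTwo (p q : MvPolynomial.restrictTotalDegree (Fin 2 × Fin n) ℂ 2) :
    MvPolynomial.restrictTotalDegree (Fin 2 × Fin n) ℂ 2 :=
  Complex.I • ⟨poisson θ p.1 q.1, (MvPolynomial.mem_restrictTotalDegree _ _ _).2
    (totalDegree_poisson_le ((MvPolynomial.mem_restrictTotalDegree _ _ _).1 p.2)
      ((MvPolynomial.mem_restrictTotalDegree _ _ _).1 q.2))⟩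

lemma bracket_toPolyTwo (p q : MvPolynomial.restrictTotalDegree (Fin 2 × Fin n) ℂ 2) :
    bracket (Submodule.inclusion (polyTwo_le_moyalAlgebra n θ) (toPolyTwo n p))
      (Submodule.inclusion (polyTwo_le_moyalAlgebra n θ) (toPolyTwo n q)) =
      (toPolyTwo n (poissonTwo θ p q)).1.toLinearMap :=
  bracket_polyMoyal ((MvPolynomial.mem_restrictTotalDegree _ _ _).1 p.2)
    ((MvPolynomial.mem_restrictTotalDegree _ _ _).1 q.2)

lemma exists_bracket_polyTwo (P Q : polyTwo n) : ∃ R : polyTwo n,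
    bracket (Submodule.inclusion (polyTwo_le_moyalAlgebra n θ) P)
      (Submodule.inclusion (polyTwo_le_moyalAlgebra n θ) Q) = R.1.toLinearMap := by
  obtain ⟨p, rfl⟩ := toPolyTwo_surjective P
  obtain ⟨q, rfl⟩ := toPolyTwo_surjective Q
  exact ⟨_, bracket_toPolyTwo p q⟩

variable (θ) in
/-- The Moyal bracket on `𝓟₂`. -/
def lieTwo (P Q : polyTwo n) : polyTwo n := (exists_bracket_polyTwo (θ := θ) P Q).choose

lemma lieTwo_spec (P Q : polyTwo n) : (lieTwo θ P Q).1.toLinearMap =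
    bracket (Submodule.inclusion (polyTwo_le_moyalAlgebra n θ) P)
      (Submodule.inclusion (polyTwo_le_moyalAlgebra n θ) Q) :=
  (exists_bracket_polyTwo P Q).choose_spec.symm

/-- A distribution is determined by its values on Schwartz functions, so the element chosen in
`lieTwo` is the Poisson bracket. All Lie axioms are transported through this identity. -/
lemma lieTwo_toPolyTwo (p q : MvPolynomial.restrictTotalDegree (Fin 2 × Fin n) ℂ 2) :
    lieTwo θ (toPolyTwo n p) (toPolyTwo n q) = toPolyTwo n (poissonTwo θ p q) := by
  have h := (lieTwo_spec (θ := θ) (toPolyTwo n p) (toPolyTwo n q)).trans (bracket_toPolyTwo p q)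
  ext f
  exact congr($h f)

lemma toPolyTwo_add (p q : MvPolynomial.restrictTotalDegree (Fin 2 × Fin n) ℂ 2) :
    toPolyTwo n (p + q) = toPolyTwo n p + toPolyTwo n q := Subtype.ext (map_add polyDist _ _)

lemma toPolyTwo_smul (c : ℂ) (p : MvPolynomial.restrictTotalDegree (Fin 2 × Fin n) ℂ 2) :
    toPolyTwo n (c • p) = c • toPolyTwo n p := Subtype.ext (map_smul polyDist _ _)

lemma toPolyTwo_zero : toPolyTwo n 0 = 0 := Subtype.ext (map_zero polyDist)

lemma lieTwo_add_left (P Q R : polyTwo n) : lieTwo θ (P + Q) R = lieTwo θ P R + lieTwo θ Q R := by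
  obtain ⟨p, rfl⟩ := toPolyTwo_surjective P
  obtain ⟨q, rfl⟩ := toPolyTwo_surjective Q
  obtain ⟨r, rfl⟩ := toPolyTwo_surjective R
  rw [← toPolyTwo_add, lieTwo_toPolyTwo, lieTwo_toPolyTwo, lieTwo_toPolyTwo, ← toPolyTwo_add]
  congr 1
  ext1
  simp [poissonTwo, poisson_add_left]

lemma lieTwo_add_right (P Q R : polyTwo n) : lieTwo θ P (Q + R) = lieTwo θ P Q + lieTwo θ P R := by
  obtain ⟨p, rfl⟩ := toPolyTwo_surjective P
  obtain ⟨q, rfl⟩ := toPolyTwo_surjective Q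
  obtain ⟨r, rfl⟩ := toPolyTwo_surjective R
  rw [← toPolyTwo_add, lieTwo_toPolyTwo, lieTwo_toPolyTwo, lieTwo_toPolyTwo, ← toPolyTwo_add]
  congr 1
  ext1
  simp [poissonTwo, poisson_add_right]

lemma lieTwo_smul_right (c : ℂ) (P Q : polyTwo n) : lieTwo θ P (c • Q) = c • lieTwo θ P Q := by
  obtain ⟨p, rfl⟩ := toPolyTwo_surjective P
  obtain ⟨q, rfl⟩ := toPolyTwo_surjective Q
  rw [← toPolyTwo_smul, lieTwo_toPolyTwo, lieTwo_toPolyTwo, ← toPolyTwo_smul]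
  congr 1
  ext1
  simp [poissonTwo, poisson_smul_right, smul_comm c]

lemma lieTwo_self (P : polyTwo n) : lieTwo θ P P = 0 := by
  obtain ⟨p, rfl⟩ := toPolyTwo_surjective P
  rw [lieTwo_toPolyTwo, ← toPolyTwo_zero]
  congr 1
  ext1
  simp [poissonTwo, self_eq_neg.1 (poisson_swap (θ := θ) p.1 p.1)]

lemma lieTwo_jacobi (P Q R : polyTwo n) :
    lieTwo θ P (lieTwo θ Q R) = lieTwo θ (lieTwo θ P Q) R + lieTwo θ Q (lieTwo θ P R) := by
  obtain ⟨p, rfl⟩ := toPolyTwo_surjective P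
  obtain ⟨q, rfl⟩ := toPolyTwo_surjective Q
  obtain ⟨r, rfl⟩ := toPolyTwo_surjective R
  simp only [lieTwo_toPolyTwo, ← toPolyTwo_add]
  congr 1
  ext1
  simp [poissonTwo, poisson_smul_right, poisson_smul_left, poisson_jacobi p.1 q.1 r.1]

variable (n θ) in
/-- The Lie ring structure on `𝓟₂` given by the Moyal bracket. -/
abbrev lieRingPolyTwo : LieRing (polyTwo n) where
  bracket := lieTwo θ
  add_lie := lieTwo_add_left
  lie_add := lieTwo_add_right
  lie_self := lieTwo_self
  leibniz_lie := lieTwo_jacobi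

variable (n θ) in
/-- The complex Lie algebra structure on `𝓟₂` given by the Moyal bracket. -/
abbrev lieAlgebraPolyTwo : letI := lieRingPolyTwo n θ; LieAlgebra ℂ (polyTwo n) :=
  letI := lieRingPolyTwo n θ
  { lie_smul := lieTwo_smul_right }

end LieAlgebra

end Moyal

theorem mainTheorem7 (n : ℕ) (θ : ℝ) [NeZero θ] :
    ∃ h : Moyal.polyTwo n ≤ Moyal.moyalAlgebra n θ,
      -- closed under the Moyal bracket
      (∀ P Q : Moyal.polyTwo n, ∃ R : Moyal.polyTwo n,
        Moyal.bracket (Submodule.inclusion h P) (Submodule.inclusion h Q) = R.1.toLinearMap) ∧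
      -- a Lie algebra for the Moyal bracket
      (∃ (𝔤 : Type) (_ : LieRing 𝔤) (_ : LieAlgebra ℂ 𝔤) (e : 𝔤 ≃ₗ[ℂ] Moyal.polyTwo n),
        ∀ X Y : 𝔤, (e ⁅X, Y⁆).1.toLinearMap =
          Moyal.bracket (Submodule.inclusion h (e X)) (Submodule.inclusion h (e Y))) ∧
      -- the Moyal bracket is `i` times the Poisson bracket
      (∀ (p q : MvPolynomial (Fin 2 × Fin n) ℂ) (hp : p.totalDegree ≤ 2) (hq : q.totalDegree ≤ 2),
        Moyal.bracket (⟨Moyal.polyDist p, h (Moyal.polyDist_mem_polyTwo hp)⟩ :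
            Moyal.moyalAlgebra n θ)
          ⟨Moyal.polyDist q, h (Moyal.polyDist_mem_polyTwo hq)⟩ =
        Complex.I • (Moyal.polyDist (Moyal.poisson θ p q)).toLinearMap) := by
  refine ⟨Moyal.polyTwo_le_moyalAlgebra n θ, Moyal.exists_bracket_polyTwo,
    ⟨Moyal.polyTwo n, Moyal.lieRingPolyTwo n θ, Moyal.lieAlgebraPolyTwo n θ,
      LinearEquiv.refl ℂ _, Moyal.lieTwo_spec⟩, fun p q hp hq => ?_⟩
  refine (Moyal.bracket_polyMoyal hp hq).trans ?_
  rw [map_smul]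
  rfl
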